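/- **Theorem.** For $B>0$ let $$H_B=\Bigl(-i\frac{\partial}{\partial x_1}+\frac{Bx_2}{2}\Bigr)^2+\Bigl(-i\frac{\partial}{\partial x_2}-\frac{Bx_1}{2}\Bigr)^2$$ be the Landau Hamiltonian in $L^2(\mathbb R^2)$, and for $\omega_1,\omega_2,\mu>0$ let $V(x)=\omega_1^2x_1^2+\omega_2^2x_2^2-\mu$. Let $H_B+V$ denote the closure in $L^2(\mathbb R^2)$ of the corresponding differential operator on Schwartz functions, and write $a_-=\max(-a,0)$ for real $a$. Then, for every $B>0$ and all $\omega_1,\omega_2,\mu>0$, the operator $H_B+V$ is self-adjoint, it has a unique bounded negative part $(H_B+V)_-$ (a bounded operator $N\ge 0$ with $H_B+V+N\ge 0$ and $(H_B+V+N)N=0$), and $$\operatorname{Tr}(H_B+V)_-\;\le\;\frac{B}{2\pi}\sum_{m=0}^\infty\int_{\mathbb R^2}\bigl((2m+1)B+V(x)\bigr)_-\,dx .$$ Moreover, the constant $1$ is sharp: for every $B>0$, if $\rho\in[0,\infty]$ is such that $$\operatorname{Tr}(H_B+V)_-\;\le\;\rho\,\frac{B}{2\pi}\sum_{m=0}^\infty\int_{\mathbb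 R^2}\bigl((2m+1)B+V(x)\bigr)_-\,dx$$ for all $\omega_1,\omega_2,\mu>0$ (with $V$ as above), then $\rho\ge 1$. -/

import Mathlib

open MeasureTheory
open scoped ENNReal SchwartzMap InnerProductSpace ContDiff

noncomputable section

/-- The configuration space `ℝ²`; the coordinates `x₁, x₂` are `x 0, x 1`. -/
abbrev Plane : Type := EuclideanSpace ℝ (Fin 2)

/-- The complex Hilbert space `L²(ℝ²)` (Lebesgue measure). -/
abbrev L2Plane : Type := Lp ℂ 2 (volume : Measure Plane)

/-- The partial derivative `∂u/∂x_{j+1}`. -/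
def partialDeriv (j : Fin 2) (u : Plane → ℂ) (x : Plane) : ℂ :=
  fderiv ℝ u x (EuclideanSpace.single j 1)

/-- `(-i ∂/∂x₁ + B x₂ / 2) u`. -/
def magMomentum₁ (B : ℝ) (u : Plane → ℂ) (x : Plane) : ℂ :=
  -Complex.I * partialDeriv 0 u x + ((B * x 1 / 2 : ℝ) : ℂ) * u x

/-- `(-i ∂/∂x₂ - B x₁ / 2) u`. -/
def magMomentum₂ (B : ℝ) (u : Plane → ℂ) (x : Plane) : ℂ :=
  -Complex.I * partialDeriv 1 u x - ((B * x 0 / 2 : ℝ) : ℂ) * u x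

/-- The differential expression of `H_B + V`, where
`H_B = (-i ∂/∂x₁ + B x₂ / 2)² + (-i ∂/∂x₂ - B x₁ / 2)²`. -/
def magSchrodingerExpr (B : ℝ) (V : Plane → ℝ) (u : Plane → ℂ) (x : Plane) : ℂ :=
  magMomentum₁ B (magMomentum₁ B u) x + magMomentum₂ B (magMomentum₂ B u) x + (V x : ℂ) * u x

lemma contDiff_magMomentum₁ (B : ℝ) {u : Plane → ℂ} (hu : ContDiff ℝ ∞ u) :
    ContDiff ℝ ∞ (magMomentum₁ B u) := by
  have h1 : ContDiff ℝ ∞ (fun x => fderiv ℝ u x (EuclideanSpace.single (0 : Fin 2) (1 : ℝ))) :=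
    (hu.fderiv_right (m := ∞) le_rfl).clm_apply contDiff_const
  have h2 : ContDiff ℝ ∞ (fun x : Plane => ((B * x 1 / 2 : ℝ) : ℂ)) :=
    Complex.ofRealCLM.contDiff.comp
      (((contDiff_const (c := B)).mul (by fun_prop : ContDiff ℝ ∞ fun x : Plane => x 1)).div_const 2)
  exact (contDiff_const.mul h1).add (h2.mul hu)

lemma contDiff_magMomentum₂ (B : ℝ) {u : Plane → ℂ} (hu : ContDiff ℝ ∞ u) :
    ContDiff ℝ ∞ (magMomentum₂ B u) := by
  have h1 : ContDiff ℝ ∞ (fun x => fderiv ℝ u x (EuclideanSpace.single (1 : Fin 2) (1 : ℝ))) :=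
    (hu.fderiv_right (m := ∞) le_rfl).clm_apply contDiff_const
  have h2 : ContDiff ℝ ∞ (fun x : Plane => ((B * x 0 / 2 : ℝ) : ℂ)) :=
    Complex.ofRealCLM.contDiff.comp
      (((contDiff_const (c := B)).mul (by fun_prop : ContDiff ℝ ∞ fun x : Plane => x 0)).div_const 2)
  exact (contDiff_const.mul h1).sub (h2.mul hu)

lemma partialDeriv_add (j : Fin 2) {u v : Plane → ℂ} (hu : ContDiff ℝ ∞ u)
    (hv : ContDiff ℝ ∞ v) : partialDeriv j (u + v) = partialDeriv j u + partialDeriv j v := by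
  ext x
  simp [partialDeriv, fderiv_add (hu.differentiable (by simp) x) (hv.differentiable (by simp) x)]

lemma partialDeriv_smul (j : Fin 2) (c : ℂ) {u : Plane → ℂ} (hu : ContDiff ℝ ∞ u) :
    partialDeriv j (c • u) = c • partialDeriv j u := by
  ext x
  simp [partialDeriv, fderiv_const_smul (hu.differentiable (by simp) x) c]

lemma magSchrodingerExpr_add (B : ℝ) (V : Plane → ℝ) {u v : Plane → ℂ} (hu : ContDiff ℝ ∞ u)
    (hv : ContDiff ℝ ∞ v) :
    magSchrodingerExpr B V (u + v) = magSchrodingerExpr B V u + magSchrodingerExpr B V v := by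
  have h1 : ∀ {u v : Plane → ℂ}, ContDiff ℝ ∞ u → ContDiff ℝ ∞ v →
      magMomentum₁ B (u + v) = magMomentum₁ B u + magMomentum₁ B v := by
    intro u v hu hv
    ext x
    simp only [magMomentum₁, partialDeriv_add 0 hu hv, Pi.add_apply]
    ring
  have h2 : ∀ {u v : Plane → ℂ}, ContDiff ℝ ∞ u → ContDiff ℝ ∞ v →
      magMomentum₂ B (u + v) = magMomentum₂ B u + magMomentum₂ B v := by
    intro u v hu hv
    ext x
    simp only [magMomentum₂, partialDeriv_add 1 hu hv, Pi.add_apply]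
    ring
  ext x
  simp only [magSchrodingerExpr, h1 hu hv, h2 hu hv,
    h1 (contDiff_magMomentum₁ B hu) (contDiff_magMomentum₁ B hv),
    h2 (contDiff_magMomentum₂ B hu) (contDiff_magMomentum₂ B hv), Pi.add_apply]
  ring

lemma magSchrodingerExpr_smul (B : ℝ) (V : Plane → ℝ) (c : ℂ) {u : Plane → ℂ}
    (hu : ContDiff ℝ ∞ u) :
    magSchrodingerExpr B V (c • u) = c • magSchrodingerExpr B V u := by
  have h1 : ∀ {u : Plane → ℂ}, ContDiff ℝ ∞ u →
      magMomentum₁ B (c • u) = c • magMomentum₁ B u := by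
    intro u hu
    ext x
    simp only [magMomentum₁, partialDeriv_smul 0 c hu, Pi.smul_apply, smul_eq_mul]
    ring
  have h2 : ∀ {u : Plane → ℂ}, ContDiff ℝ ∞ u →
      magMomentum₂ B (c • u) = c • magMomentum₂ B u := by
    intro u hu
    ext x
    simp only [magMomentum₂, partialDeriv_smul 1 c hu, Pi.smul_apply, smul_eq_mul]
    ring
  ext x
  simp only [magSchrodingerExpr, h1 hu, h2 hu, h1 (contDiff_magMomentum₁ B hu),
    h2 (contDiff_magMomentum₂ B hu), Pi.smul_apply, smul_eq_mul]
  ring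

/-- The graph of `H_B + V` on Schwartz functions: all pairs `(φ, (H_B + V) φ)` of elements of
`L²(ℝ²)` with `φ` a Schwartz function. For a polynomial `V`, every Schwartz function occurs. -/
def magSchrodingerGraph (B : ℝ) (V : Plane → ℝ) : Submodule ℂ (L2Plane × L2Plane) where
  carrier := {p | ∃ φ : 𝓢(Plane, ℂ), p.1 =ᵐ[volume] φ ∧
    p.2 =ᵐ[volume] magSchrodingerExpr B V φ}
  zero_mem' := by
    refine ⟨0, Lp.coeFn_zero _ _ _, ?_⟩
    have h := magSchrodingerExpr_smul B V 0 (u := 0) contDiff_const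
    simp only [zero_smul] at h
    have h0 : ((0 : 𝓢(Plane, ℂ)) : Plane → ℂ) = 0 := rfl
    rw [h0, h]
    exact Lp.coeFn_zero _ _ _
  add_mem' := by
    rintro p q ⟨φ, h1, h2⟩ ⟨ψ, h3, h4⟩
    refine ⟨φ + ψ, (Lp.coeFn_add _ _).trans (h1.add h3), ?_⟩
    have h0 : ((φ + ψ : 𝓢(Plane, ℂ)) : Plane → ℂ) = ⇑φ + ⇑ψ := rfl
    rw [h0, magSchrodingerExpr_add B V (φ.smooth ⊤) (ψ.smooth ⊤)]
    exact (Lp.coeFn_add _ _).trans (h2.add h4)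
  smul_mem' := by
    rintro c p ⟨φ, h1, h2⟩
    refine ⟨c • φ, (Lp.coeFn_smul _ _).trans (h1.const_smul c), ?_⟩
    have h0 : ((c • φ : 𝓢(Plane, ℂ)) : Plane → ℂ) = c • ⇑φ := rfl
    rw [h0, magSchrodingerExpr_smul B V c (φ.smooth ⊤)]
    exact (Lp.coeFn_smul _ _).trans (h2.const_smul c)

/-- The operator `H_B + V` in `L²(ℝ²)`: the closure of the differential operator defined on
Schwartz functions. -/
def magSchrodinger (B : ℝ) (V : Plane → ℝ) : L2Plane →ₗ.[ℂ] L2Plane :=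
  (magSchrodingerGraph B V).toLinearPMap.closure

/-- `N` is the negative part `A₋` of the self-adjoint, lower semibounded operator `A`: `N` is a
bounded nonnegative operator such that `A₊ := A + N` is nonnegative and `A₊ N = 0`. For
self-adjoint `A` these properties determine `N`. -/
structure IsNegPart {H : Type*} [NormedAddCommGroup H] [InnerProductSpace ℂ H]
    (A : H →ₗ.[ℂ] H) (N : H →L[ℂ] H) : Prop where
  isPositive : N.IsPositive
  add_nonneg : ∀ x : A.domain, 0 ≤ (⟪(x : H), A x + N x⟫_ℂ).re
  add_mul_eq_zero : ∀ x : H, ∃ h : N x ∈ A.domain, A ⟨N x, h⟩ + N (N x) = 0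

/-- The trace `∑ᵢ ⟨bᵢ, T bᵢ⟩ ∈ [0, ∞]` of a bounded nonnegative operator `T`, where `b` is an
orthonormal basis (on whose choice the value does not depend). -/
def posTrace {H : Type*} [NormedAddCommGroup H] [InnerProductSpace ℂ H] [CompleteSpace H]
    (T : H →L[ℂ] H) : ℝ≥0∞ :=
  ∑' b : (exists_hilbertBasis ℂ H).choose, ENNReal.ofReal (⟪(b : H), T b⟫_ℂ).re

/-- `Tr A₋`, the trace of the negative part of `A` (`∞` if `A` has no bounded negative part). -/
def negTrace {H : Type*} [NormedAddCommGroup H] [InnerProductSpace ℂ H] [CompleteSpace H]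
    (A : H →ₗ.[ℂ] H) : ℝ≥0∞ :=
  ⨅ (N : H →L[ℂ] H) (_ : IsNegPart A N), posTrace N

/-- `(B / 2π) ∑_{m ≥ 0} ∫ ((2m + 1) B + V(x))₋ dx`, where `a⁻ = max (-a) 0`. -/
def magSemiclassical (B : ℝ) (V : Plane → ℝ) : ℝ≥0∞ :=
  ENNReal.ofReal (B / (2 * Real.pi)) *
    ∑' m : ℕ, ∫⁻ x : Plane, ENNReal.ofReal (((2 * (m : ℝ) + 1) * B + V x)⁻)

/-- `V(x) = ω₁² x₁² + ω₂² x₂² - μ`. -/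
def oscPotential (ω₁ ω₂ μ : ℝ) (x : Plane) : ℝ :=
  ω₁ ^ 2 * x 0 ^ 2 + ω₂ ^ 2 * x 1 ^ 2 - μ

end

/-!
The operator `H_B + V` is a sum of two harmonic oscillators in disguise: if `ν` and `ν'` are its
normal frequencies, with `ν ν' = ω₁ ω₂` and `ν² + ν'² = ω₁² + ω₂² + B²`, then ladder operators
acting on a Gaussian ground state produce Schwartz eigenfunctions with eigenvalues
`(2 j + 1) ν + (2 k + 1) ν' - μ`. They form an orthogonal basis of `L²(ℝ²)`, so the closure is
diagonal and `Tr (H_B + V)₋` is a double sum over `j` and `k`. The sum over `k` is a midpoint sum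
of a convex function, which bounds the trace by `ν / (4 ω₁ ω₂) * ∑ⱼ (μ - (2 j + 1) ν)₊²`. At
`ν = B` this is the semiclassical expression, and `t ↦ t ∑ⱼ (μ - (2 j + 1) t)₊²` is nonincreasing,
while `B ≤ ν` for the larger frequency. For sharpness, let `ω₁ = ω₂ → 0` at `μ = 2 B`.
-/

/-! ### Operators diagonal in a Hilbert basis -/

section Diagonal

variable {H ι : Type*} [NormedAddCommGroup H] [InnerProductSpace ℂ H]
  {e : HilbertBasis ι ℂ H} {ev : ι → ℝ} {A : H →ₗ.[ℂ] H} {N : H →L[ℂ] H}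

/-- `A` is the maximal operator which is diagonal in the Hilbert basis `e` with real eigenvalues
`ev`: the spectral theorem for `A` in multiplication form, stated through the graph so that it
also determines the domain. -/
def IsDiagonal (e : HilbertBasis ι ℂ H) (ev : ι → ℝ) (A : H →ₗ.[ℂ] H) : Prop :=
  ∀ x y : H, (x, y) ∈ A.graph ↔ ∀ i, ⟪e i, y⟫_ℂ = ev i * ⟪e i, x⟫_ℂ

lemma hilbertBasis_ext_inner (e : HilbertBasis ι ℂ H) {x y : H}
    (h : ∀ i, ⟪e i, x⟫_ℂ = ⟪e i, y⟫_ℂ) : x = y := by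
  apply e.repr.injective
  ext i
  simpa only [e.repr_apply_apply] using h i

lemma inner_hilbertBasis [DecidableEq ι] (e : HilbertBasis ι ℂ H) (i j : ι) :
    ⟪e i, e j⟫_ℂ = if i = j then 1 else 0 :=
  orthonormal_iff_ite.1 e.orthonormal i j

lemma mem_topologicalClosure_iff_inner (e : HilbertBasis ι ℂ H) {G : Submodule ℂ (H × H)}
    (he : ∀ i, (e i, (ev i : ℂ) • e i) ∈ G)
    (hG : ∀ p ∈ G, ∀ i, ⟪e i, p.2⟫_ℂ = ev i * ⟪e i, p.1⟫_ℂ) (p : H × H) :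
    p ∈ G.topologicalClosure ↔ ∀ i, ⟪e i, p.2⟫_ℂ = ev i * ⟪e i, p.1⟫_ℂ := by
  constructor
  · intro hp i
    have hclosed : IsClosed {p : H × H | ⟪e i, p.2⟫_ℂ = ev i * ⟪e i, p.1⟫_ℂ} :=
      isClosed_eq (by fun_prop) (by fun_prop)
    exact closure_minimal (fun q hq => hG q hq i) hclosed hp
  · intro hp
    refine mem_closure_of_tendsto ((e.hasSum_repr p.1).prodMk (e.hasSum_repr p.2))
      (Filter.Eventually.of_forall fun s => Submodule.sum_mem _ fun i _ => ?_)
    have hterm : ((e.repr p.1 i • e i, e.repr p.2 i • e i) : H × H) =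
        e.repr p.1 i • (e i, (ev i : ℂ) • e i) := by
      rw [e.repr_apply_apply, e.repr_apply_apply, hp i, Prod.smul_mk, smul_smul, mul_comm]
    exact hterm ▸ G.smul_mem _ (he i)

theorem isDiagonal_closure [CompleteSpace H] (e : HilbertBasis ι ℂ H)
    {G : Submodule ℂ (H × H)} (he : ∀ i, (e i, (ev i : ℂ) • e i) ∈ G)
    (hG : ∀ p ∈ G, ∀ q ∈ G, ⟪p.2, q.1⟫_ℂ = ⟪p.1, q.2⟫_ℂ) :
    IsDiagonal e ev G.toLinearPMap.closure := by
  have hdiag : ∀ p ∈ G, ∀ i, ⟪e i, p.2⟫_ℂ = ev i * ⟪e i, p.1⟫_ℂ := by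
    intro p hp i
    simpa [inner_smul_left] using (hG _ (he i) _ hp).symm
  have hcl := mem_topologicalClosure_iff_inner e he hdiag
  have hfun : ∀ q ∈ G.topologicalClosure, q.1 = 0 → q.2 = 0 := by
    intro q hq h0
    refine hilbertBasis_ext_inner e fun i => ?_
    rw [(hcl q).1 hq i, h0, inner_zero_right, mul_zero]
  have hgraph : G.toLinearPMap.graph = G :=
    G.toLinearPMap_graph_eq fun x hx h0 => hfun x (G.le_topologicalClosure hx) h0
  have hclosable : G.toLinearPMap.IsClosable := by
    refine ⟨G.topologicalClosure.toLinearPMap, ?_⟩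
    rw [hgraph, Submodule.toLinearPMap_graph_eq _ hfun]
  intro x y
  rw [← hclosable.graph_closure_eq_closure_graph, hgraph, hcl]

lemma exists_hilbertBasis_eq_smul [CompleteSpace H] {f : ι → H} (hne : ∀ i, f i ≠ 0)
    (horth : Pairwise fun i j => ⟪f i, f j⟫_ℂ = 0)
    (htot : ∀ x, (∀ i, ⟪f i, x⟫_ℂ = 0) → x = 0) :
    ∃ e : HilbertBasis ι ℂ H, ∀ i, e i = ((‖f i‖⁻¹ : ℝ) : ℂ) • f i := by
  have hnorm : ∀ i, ((‖f i‖⁻¹ : ℝ) : ℂ) ≠ 0 := fun i =>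
    Complex.ofReal_ne_zero.2 (inv_ne_zero (norm_ne_zero_iff.2 (hne i)))
  have hon : Orthonormal ℂ fun i => ((‖f i‖⁻¹ : ℝ) : ℂ) • f i := by
    refine ⟨fun i => ?_, fun i j hij => ?_⟩
    · simpa using norm_smul_inv_norm (𝕜 := ℂ) (hne i)
    · simp only [inner_smul_left, inner_smul_right, horth hij, mul_zero]
  refine ⟨HilbertBasis.mkOfOrthogonalEqBot hon ((Submodule.eq_bot_iff _).2 fun x hx =>
    htot x fun i => ?_), fun i => by rw [HilbertBasis.coe_mkOfOrthogonalEqBot]⟩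
  have h := hx _ (Submodule.subset_span ⟨i, rfl⟩)
  rw [inner_smul_left] at h
  exact (mul_eq_zero.1 h).resolve_left ((map_ne_zero _).2 (hnorm i))

/-- Essential self-adjointness of a symmetric operator with enough eigenvectors. -/
theorem exists_isDiagonal_closure [CompleteSpace H] {G : Submodule ℂ (H × H)}
    (hG : ∀ p ∈ G, ∀ q ∈ G, ⟪p.2, q.1⟫_ℂ = ⟪p.1, q.2⟫_ℂ) {f : ι → H} (hne : ∀ i, f i ≠ 0)
    (horth : Pairwise fun i j => ⟪f i, f j⟫_ℂ = 0)
    (htot : ∀ x, (∀ i, ⟪f i, x⟫_ℂ = 0) → x = 0)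
    (hf : ∀ i, (f i, (ev i : ℂ) • f i) ∈ G) :
    ∃ e : HilbertBasis ι ℂ H, IsDiagonal e ev G.toLinearPMap.closure := by
  obtain ⟨e, he⟩ := exists_hilbertBasis_eq_smul hne horth htot
  refine ⟨e, isDiagonal_closure e (fun i => ?_) hG⟩
  rw [he, smul_comm]
  exact G.smul_mem _ (hf i)

namespace IsDiagonal

lemma exists_apply_eq (hA : IsDiagonal e ev A) {x y : H}
    (h : ∀ i, ⟪e i, y⟫_ℂ = ev i * ⟪e i, x⟫_ℂ) : ∃ hx : x ∈ A.domain, A ⟨x, hx⟩ = y := by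
  obtain ⟨z, rfl, hz⟩ := A.mem_graph_iff.1 ((hA x y).2 h)
  exact ⟨z.2, hz⟩

lemma inner_apply (hA : IsDiagonal e ev A) (x : A.domain) (i : ι) :
    ⟪e i, A x⟫_ℂ = ev i * ⟪e i, (x : H)⟫_ℂ :=
  (hA x (A x)).1 (A.mem_graph x) i

lemma apply_basis (hA : IsDiagonal e ev A) (i : ι) :
    ∃ hx : e i ∈ A.domain, A ⟨e i, hx⟩ = (ev i : ℂ) • e i := by
  classical
  refine hA.exists_apply_eq fun j => ?_
  rw [inner_smul_right, inner_hilbertBasis]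
  split_ifs with h <;> simp [h]

lemma dense_domain (hA : IsDiagonal e ev A) : Dense (A.domain : Set H) := by
  refine (Submodule.dense_iff_topologicalClosure_eq_top.2 e.dense_span).mono
    (Submodule.span_le.2 ?_)
  rintro _ ⟨i, rfl⟩
  exact (hA.apply_basis i).1

lemma isFormalAdjoint (hA : IsDiagonal e ev A) : A.IsFormalAdjoint A := by
  intro x y
  rw [← e.tsum_inner_mul_inner, ← e.tsum_inner_mul_inner]
  refine tsum_congr fun i => ?_
  rw [hA.inner_apply, ← inner_conj_symm, hA.inner_apply, ← inner_conj_symm (x : H), map_mul,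
    Complex.conj_ofReal, mul_left_comm, mul_assoc]

theorem isSelfAdjoint [CompleteSpace H] (hA : IsDiagonal e ev A) : IsSelfAdjoint A := by
  refine LinearPMap.isSelfAdjoint_def.2 (le_antisymm ?_
    (hA.isFormalAdjoint.le_adjoint hA.dense_domain))
  refine LinearPMap.le_of_le_graph fun p hp => ?_
  obtain ⟨z, hz, hAz⟩ := LinearPMap.mem_graph_iff _ |>.1 hp
  refine (hA p.1 p.2).2 fun i => ?_
  obtain ⟨hi, hAi⟩ := hA.apply_basis i
  have h := A.adjoint_isFormalAdjoint hA.dense_domain z ⟨e i, hi⟩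
  rw [hAi, hAz, hz, inner_smul_right] at h
  rw [← inner_conj_symm, h, map_mul, Complex.conj_ofReal, inner_conj_symm]

end IsDiagonal

/-! ### Negative parts and traces -/

namespace IsNegPart

lemma apply_mem_domain (hN : IsNegPart A N) (x : H) : N x ∈ A.domain :=
  (hN.add_mul_eq_zero x).1

lemma apply_apply (hN : IsNegPart A N) (x : H) :
    A ⟨N x, hN.apply_mem_domain x⟩ = -N (N x) :=
  eq_neg_of_add_eq_zero_left (hN.add_mul_eq_zero x).2

variable {x : A.domain} {lam : ℝ}

lemma apply_apply_eigenvector (hA : A.IsFormalAdjoint A) (hN : IsNegPart A N)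
    (hx : A x = (lam : ℂ) • (x : H)) : N (N x) = -((lam : ℂ) • N x) := by
  refine ext_inner_right ℂ fun y => ?_
  have hNsymm := hN.isPositive.inner_left_eq_inner_right
  have h := hA x ⟨N y, hN.apply_mem_domain y⟩
  rw [hx, hN.apply_apply, inner_neg_right, ← hNsymm, ← hNsymm, ← hNsymm, map_smul] at h
  rw [inner_neg_left, h, neg_neg]

lemma apply_eigenvector_of_nonneg (hA : A.IsFormalAdjoint A) (hN : IsNegPart A N)
    (hx : A x = (lam : ℂ) • (x : H)) (hlam : 0 ≤ lam) : N x = 0 := by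
  have hnorm : ‖N x‖ ^ 2 = -(lam * (⟪(x : H), N x⟫_ℂ).re) := by
    rw [← inner_self_eq_norm_sq (𝕜 := ℂ), hN.isPositive.inner_left_eq_inner_right,
      hN.apply_apply_eigenvector hA hx, inner_neg_right, inner_smul_right]
    simp
  have hpos : 0 ≤ (⟪(x : H), N x⟫_ℂ).re := hN.isPositive.re_inner_nonneg_right x
  exact norm_eq_zero.1 (pow_eq_zero_iff two_ne_zero |>.1
    (le_antisymm (hnorm.trans_le (neg_nonpos.2 (mul_nonneg hlam hpos))) (sq_nonneg _)))

lemma apply_eigenvector_of_neg (hA : A.IsFormalAdjoint A) (hN : IsNegPart A N)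
    (hx : A x = (lam : ℂ) • (x : H)) (hlam : lam < 0) : N x = -((lam : ℂ) • (x : H)) := by
  have hNN := hN.apply_apply_eigenvector hA hx
  -- `w = A₊ x` is an eigenvector of `A` with the negative eigenvalue `lam`, but `N w = 0`.
  set w : A.domain := ⟨N x, hN.apply_mem_domain x⟩ + (lam : ℂ) • x with hw
  have hwx : (w : H) = N x + (lam : ℂ) • (x : H) := rfl
  have hNw : N w = 0 := by rw [hwx, map_add, map_smul, hNN, neg_add_cancel]
  have hAw : A w = (lam : ℂ) • (w : H) := by
    rw [hw, A.map_add, A.map_smul, hx, hN.apply_apply, hNN, neg_neg, ← smul_add, ← hwx]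
  have hnonneg : 0 ≤ lam * ‖(w : H)‖ ^ 2 := by
    have h := hN.add_nonneg w
    rwa [hAw, hNw, add_zero, inner_smul_right, Complex.re_ofReal_mul, ← RCLike.re_to_complex,
      inner_self_eq_norm_sq] at h
  have hw0 : (w : H) = 0 := by
    by_contra hne
    exact (mul_neg_of_neg_of_pos hlam (by positivity)).not_ge hnonneg
  exact eq_neg_of_add_eq_zero_left (hwx.symm.trans hw0)

theorem apply_eigenvector (hA : A.IsFormalAdjoint A) (hN : IsNegPart A N)
    (hx : A x = (lam : ℂ) • (x : H)) : N x = ((lam⁻ : ℝ) : ℂ) • (x : H) := by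
  rcases le_or_gt 0 lam with h | h
  · simp [hN.apply_eigenvector_of_nonneg hA hx h, negPart_eq_zero.2 h]
  · simp [hN.apply_eigenvector_of_neg hA hx h, negPart_of_nonpos h.le]

end IsNegPart

/-- The finite-rank operator `∑_{i ∈ s} c i |e i⟩⟨e i|`. -/
noncomputable def diagonalOp (e : HilbertBasis ι ℂ H) (s : Finset ι) (c : ι → ℝ) : H →L[ℂ] H :=
  ∑ i ∈ s, (c i : ℂ) • InnerProductSpace.rankOne ℂ (e i) (e i)

lemma inner_diagonalOp (e : HilbertBasis ι ℂ H) {s : Finset ι} {c : ι → ℝ}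
    (hs : ∀ i, i ∉ s → c i = 0) (x : H) (j : ι) :
    ⟪e j, diagonalOp e s c x⟫_ℂ = c j * ⟪e j, x⟫_ℂ := by
  classical
  have hc : j ∉ s → (c j : ℂ) = 0 := fun hj => by rw [hs j hj, Complex.ofReal_zero]
  simp only [diagonalOp, sum_apply, smul_apply,
    InnerProductSpace.rankOne_apply, inner_sum, inner_smul_right, inner_hilbertBasis, mul_ite,
    mul_one, mul_zero, Finset.sum_ite_eq]
  split_ifs with hj
  · rfl
  · rw [hc hj, zero_mul]

lemma isPositive_diagonalOp (e : HilbertBasis ι ℂ H) (s : Finset ι) {c : ι → ℝ}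
    (hc : ∀ i, 0 ≤ c i) : (diagonalOp e s c).IsPositive :=
  ContinuousLinearMap.isPositive_sum s fun i _ =>
    (InnerProductSpace.isPositive_rankOne_self _).smul_of_nonneg
      (Complex.zero_le_real.2 (hc i))

lemma ofReal_norm_sq_eq_tsum (e : HilbertBasis ι ℂ H) (x : H) :
    ENNReal.ofReal (‖x‖ ^ 2) = ∑' i, ENNReal.ofReal (‖⟪e i, x⟫_ℂ‖ ^ 2) := by
  have h := Complex.hasSum_re (e.hasSum_inner_mul_inner x x)
  rw [← RCLike.re_to_complex, inner_self_eq_norm_sq] at h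
  have hterm : ∀ i, (⟪x, e i⟫_ℂ * ⟪e i, x⟫_ℂ).re = ‖⟪e i, x⟫_ℂ‖ ^ 2 := fun i => by
    rw [← inner_conj_symm, Complex.conj_mul', ← Complex.ofReal_pow, Complex.ofReal_re]
  simp only [hterm] at h
  rw [← h.tsum_eq, ENNReal.ofReal_tsum_of_nonneg (fun _ => sq_nonneg _) h.summable]

theorem posTrace_eq_tsum [CompleteSpace H] (hN : N.IsPositive) (e : HilbertBasis ι ℂ H) :
    posTrace N = ∑' i, ENNReal.ofReal (⟪e i, N (e i)⟫_ℂ).re := by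
  obtain ⟨b, hb⟩ := (exists_hilbertBasis ℂ H).choose_spec
  set S := CFC.sqrt N
  have hS : S.IsPositive := S.nonneg_iff_isPositive.1 (CFC.sqrt_nonneg N)
  have hSS : ∀ x, (⟪x, N x⟫_ℂ).re = ‖S x‖ ^ 2 := fun x => by
    rw [← CFC.sqrt_mul_sqrt_self N (N.nonneg_iff_isPositive.2 hN),
      mul_apply_eq_comp, ← hS.inner_left_eq_inner_right]
    exact inner_self_eq_norm_sq (𝕜 := ℂ) (S x)
  calc posTrace N
      = ∑' v : (exists_hilbertBasis ℂ H).choose, ∑' i,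
          ENNReal.ofReal (‖⟪e i, S v⟫_ℂ‖ ^ 2) :=
        tsum_congr fun v => by rw [hSS, ofReal_norm_sq_eq_tsum e]
    _ = ∑' i, ∑' v : (exists_hilbertBasis ℂ H).choose,
          ENNReal.ofReal (‖⟪e i, S v⟫_ℂ‖ ^ 2) := ENNReal.tsum_comm
    _ = ∑' i, ENNReal.ofReal (⟪e i, N (e i)⟫_ℂ).re := tsum_congr fun i => by
        rw [hSS, ofReal_norm_sq_eq_tsum b, hb]
        exact tsum_congr fun v => by rw [← hS.inner_left_eq_inner_right, norm_inner_symm]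

namespace IsDiagonal

lemma isNegPart_diagonalOp (hA : IsDiagonal e ev A) {s : Finset ι}
    (hs : ∀ i, i ∉ s → 0 ≤ ev i) : IsNegPart A (diagonalOp e s fun i => (ev i)⁻) := by
  have hinner := inner_diagonalOp e (fun i hi => negPart_eq_zero.2 (hs i hi))
  set N := diagonalOp e s fun i => (ev i)⁻
  refine ⟨isPositive_diagonalOp e s fun i => negPart_nonneg _, fun x => ?_, fun x => ?_⟩
  · refine (Complex.hasSum_re (e.hasSum_inner_mul_inner (x : H) (A x + N x))).nonneg fun i => ?_
    have hev : ev i + (ev i)⁻ = (ev i)⁺ := by linarith [posPart_sub_negPart (ev i)]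
    rw [inner_add_right, hA.inner_apply, hinner, ← add_mul, mul_left_comm,
      ← inner_conj_symm (x : H) (e i), Complex.conj_mul', ← Complex.ofReal_add, hev,
      Complex.re_ofReal_mul, ← Complex.ofReal_pow, Complex.ofReal_re]
    exact mul_nonneg (posPart_nonneg _) (sq_nonneg _)
  · obtain ⟨hx, hAx⟩ := hA.exists_apply_eq (x := N x) (y := -N (N x)) fun i => by
      have hev : -((ev i)⁻ * (ev i)⁻) = ev i * (ev i)⁻ := by
        rcases le_total 0 (ev i) with h | h
        · simp [negPart_eq_zero.2 h]
        · simp [negPart_of_nonpos h]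
      rw [inner_neg_right, hinner, hinner, ← mul_assoc, ← mul_assoc, ← neg_mul]
      exact_mod_cast congrArg (fun r : ℝ => (r : ℂ) * ⟪e i, x⟫_ℂ) hev
    exact ⟨hx, by rw [hAx, neg_add_cancel]⟩

lemma negPart_apply_basis (hA : IsDiagonal e ev A) (hN : IsNegPart A N) (i : ι) :
    N (e i) = (((ev i)⁻ : ℝ) : ℂ) • e i := by
  obtain ⟨hi, hAi⟩ := hA.apply_basis i
  exact hN.apply_eigenvector hA.isFormalAdjoint hAi

theorem existsUnique_isNegPart (hA : IsDiagonal e ev A) {s : Finset ι}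
    (hs : ∀ i, i ∉ s → 0 ≤ ev i) : ∃! N : H →L[ℂ] H, IsNegPart A N := by
  refine ⟨_, hA.isNegPart_diagonalOp hs, fun N hN => ContinuousLinearMap.ext_on
    (Submodule.dense_iff_topologicalClosure_eq_top.2 e.dense_span) ?_⟩
  rintro _ ⟨i, rfl⟩
  rw [hA.negPart_apply_basis hN, hA.negPart_apply_basis (hA.isNegPart_diagonalOp hs)]

lemma posTrace_negPart [CompleteSpace H] (hA : IsDiagonal e ev A) (hN : IsNegPart A N) :
    posTrace N = ∑' i, ENNReal.ofReal (ev i)⁻ := by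
  classical
  rw [posTrace_eq_tsum hN.isPositive e]
  refine tsum_congr fun i => ?_
  rw [hA.negPart_apply_basis hN, inner_smul_right, inner_hilbertBasis, if_pos rfl, mul_one,
    Complex.ofReal_re]

theorem negTrace_eq_tsum [CompleteSpace H] (hA : IsDiagonal e ev A) (hN : IsNegPart A N) :
    negTrace A = ∑' i, ENNReal.ofReal (ev i)⁻ :=
  le_antisymm ((iInf₂_le N hN).trans_eq (hA.posTrace_negPart hN))
    (le_iInf₂ fun _ hN' => (hA.posTrace_negPart hN').ge)

end IsDiagonal

end Diagonal

/-! ### Ladder operators -/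

section Ladder

variable {V H : Type*} [AddCommGroup V] [Module ℂ V] [NormedAddCommGroup H]
  [InnerProductSpace ℂ H] {T : V →ₗ[ℂ] H} {K a a' b b' : Module.End ℂ V} {ca cb : ℝ} {u v w : V}

lemma apply_pow_eq_smul_of_lie {ε ε₀ : ℂ} (hK : ⁅K, a'⁆ = ε • a') (hu : K u = ε₀ • u) (n : ℕ) :
    K ((a' ^ n) u) = (ε₀ + n * ε) • (a' ^ n) u := by
  induction n with
  | zero => simpa using hu
  | succ n ih =>
    have hcomm : ∀ x, K (a' x) = a' (K x) + ε • a' x := fun x => by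
      rw [← LinearMap.smul_apply, ← hK, Ring.lie_def]
      simp
    rw [pow_succ', Module.End.mul_apply, hcomm, ih, map_smul, ← add_smul]
    push_cast
    ring_nf

/-- An annihilation operator `a` and the creation operator `a'`, mutually adjoint for the inner
product pulled back along `T` (the embedding of a common invariant domain into the Hilbert
space). -/
structure IsLadder (T : V →ₗ[ℂ] H) (a a' : Module.End ℂ V) (c : ℝ) : Prop where
  pos : 0 < c
  lie_eq : ⁅a, a'⁆ = (c : ℂ) • 1
  inner_eq : ∀ u w, ⟪T (a u), T w⟫_ℂ = ⟪T u, T (a' w)⟫_ℂ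

namespace IsLadder

lemma inner_raise (h : IsLadder T a a' ca) (u w : V) : ⟪T (a' u), T w⟫_ℂ = ⟪T u, T (a w)⟫_ℂ := by
  rw [← inner_conj_symm, ← h.inner_eq, inner_conj_symm]

lemma lower_pow (h : IsLadder T a a' ca) (hu : a u = 0) (j : ℕ) :
    a ((a' ^ (j + 1)) u) = ((j + 1 : ℂ) * ca) • (a' ^ j) u := by
  have hcomm : ∀ x, a (a' x) = a' (a x) + (ca : ℂ) • x := fun x => by
    rw [← sub_eq_iff_eq_add']
    simpa [Ring.lie_def] using LinearMap.congr_fun h.lie_eq x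
  induction j with
  | zero => simp [hcomm, hu]
  | succ j ih =>
    rw [pow_succ', Module.End.mul_apply, hcomm, ih, map_smul, ← Module.End.mul_apply, ← pow_succ',
      ← add_smul]
    push_cast
    ring_nf

lemma inner_pow_pow (h : IsLadder T a a' ca) (hu : a u = 0) (hw : a w = 0) (j k : ℕ) :
    ⟪T ((a' ^ j) u), T ((a' ^ k) w)⟫_ℂ =
      if j = k then (j.factorial * ca ^ j : ℂ) * ⟪T u, T w⟫_ℂ else 0 := by
  induction j generalizing k with
  | zero =>
    cases k with
    | zero => simp
    | succ k => simp [pow_succ', ← h.inner_eq, hu]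
  | succ j ih =>
    rw [pow_succ', Module.End.mul_apply, h.inner_raise]
    cases k with
    | zero => simp [hw]
    | succ k =>
      rw [h.lower_pow hw, map_smul, inner_smul_right, ih]
      simp only [Nat.add_right_cancel_iff, Nat.factorial_succ]
      split_ifs with hjk
      · subst hjk
        push_cast
        ring
      · exact mul_zero _

end IsLadder

/-- The excited states `a'ʲ b'ᵏ v`. -/
def ladderState (a' b' : Module.End ℂ V) (v : V) (p : ℕ × ℕ) : V := (a' ^ p.1) ((b' ^ p.2) v)

/-- The algebraic Fock space spanned by the excited states. -/
def ladderSpan (a' b' : Module.End ℂ V) (v : V) : Submodule ℂ V :=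
  Submodule.span ℂ (Set.range (ladderState a' b' v))

lemma apply_ladderState {ea eb e₀ : ℂ} (ha : ⁅K, a'⁆ = ea • a') (hb : ⁅K, b'⁆ = eb • b')
    (hv : K v = e₀ • v) (p : ℕ × ℕ) :
    K (ladderState a' b' v p) = (e₀ + p.2 * eb + p.1 * ea) • ladderState a' b' v p :=
  apply_pow_eq_smul_of_lie ha (apply_pow_eq_smul_of_lie hb hv p.2) p.1

/-- Two commuting ladders `(a, a')` and `(b, b')` with the common vacuum vector `v`. -/
structure IsLadderPair (T : V →ₗ[ℂ] H) (a a' b b' : Module.End ℂ V) (ca cb : ℝ) (v : V) :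
    Prop where
  fst : IsLadder T a a' ca
  snd : IsLadder T b b' cb
  commute_raise : Commute a' b'
  commute_fst : Commute a b'
  commute_snd : Commute b a'
  fst_vacuum : a v = 0
  snd_vacuum : b v = 0
  vacuum_ne_zero : T v ≠ 0

namespace IsLadderPair

lemma fst_apply_pow (h : IsLadderPair T a a' b b' ca cb v) (k : ℕ) : a ((b' ^ k) v) = 0 := by
  rw [← Module.End.mul_apply, (h.commute_fst.pow_right k).eq, Module.End.mul_apply, h.fst_vacuum,
    map_zero]

lemma inner_ladderState (h : IsLadderPair T a a' b b' ca cb v) (p q : ℕ × ℕ) :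
    ⟪T (ladderState a' b' v p), T (ladderState a' b' v q)⟫_ℂ =
      if p = q then (p.1.factorial * ca ^ p.1 : ℂ) * ((p.2.factorial * cb ^ p.2) *
        ⟪T v, T v⟫_ℂ) else 0 := by
  rw [ladderState, ladderState, h.fst.inner_pow_pow (h.fst_apply_pow _) (h.fst_apply_pow _),
    h.snd.inner_pow_pow h.snd_vacuum h.snd_vacuum]
  simp only [Prod.ext_iff]
  split_ifs <;> simp_all

lemma pairwise_inner_eq_zero (h : IsLadderPair T a a' b b' ca cb v) :
    Pairwise fun p q => ⟪T (ladderState a' b' v p), T (ladderState a' b' v q)⟫_ℂ = 0 :=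
  fun p q hpq => (h.inner_ladderState p q).trans (if_neg hpq)

lemma map_ladderState_ne_zero (h : IsLadderPair T a a' b b' ca cb v) (p : ℕ × ℕ) :
    T (ladderState a' b' v p) ≠ 0 := by
  rw [← inner_self_ne_zero (𝕜 := ℂ), h.inner_ladderState, if_pos rfl]
  have hfact : ∀ n : ℕ, (n.factorial : ℂ) ≠ 0 := fun n => mod_cast n.factorial_ne_zero
  have hca : (ca : ℂ) ≠ 0 := mod_cast h.fst.pos.ne'
  have hcb : (cb : ℂ) ≠ 0 := mod_cast h.snd.pos.ne'
  have hv := inner_self_ne_zero (𝕜 := ℂ).2 h.vacuum_ne_zero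
  exact mul_ne_zero (mul_ne_zero (hfact _) (pow_ne_zero _ hca))
    (mul_ne_zero (mul_ne_zero (hfact _) (pow_ne_zero _ hcb)) hv)

lemma lower_fst_ladderState (h : IsLadderPair T a a' b b' ca cb v) (j k : ℕ) :
    a (ladderState a' b' v (j + 1, k)) = ((j + 1 : ℂ) * ca) • ladderState a' b' v (j, k) :=
  h.fst.lower_pow (h.fst_apply_pow k) j

lemma lower_snd_ladderState (h : IsLadderPair T a a' b b' ca cb v) (j k : ℕ) :
    b (ladderState a' b' v (j, k + 1)) = ((k + 1 : ℂ) * cb) • ladderState a' b' v (j, k) := by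
  simp only [ladderState]
  rw [← Module.End.mul_apply, (h.commute_snd.pow_right j).eq, Module.End.mul_apply,
    h.snd.lower_pow h.snd_vacuum, map_smul]

lemma ladderSpan_le_comap (h : IsLadderPair T a a' b b' ca cb v) {q : Module.End ℂ V}
    (hq : q ∈ Submodule.span ℂ {a, a', b, b'}) :
    ladderSpan a' b' v ≤ (ladderSpan a' b' v).comap q := by
  have hmem : ∀ j k, ladderState a' b' v (j, k) ∈ ladderSpan a' b' v := fun j k =>
    Submodule.subset_span ⟨(j, k), rfl⟩
  refine Submodule.span_le.2 ?_
  rintro _ ⟨⟨j, k⟩, rfl⟩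
  induction hq using Submodule.span_induction with
  | zero => exact (ladderSpan a' b' v).zero_mem
  | add q r _ _ hq hr => exact (ladderSpan a' b' v).add_mem hq hr
  | smul c q _ hq => exact (ladderSpan a' b' v).smul_mem c hq
  | mem q hq =>
    rcases hq with rfl | rfl | rfl | rfl
    · cases j with
      | zero =>
        have h0 : q (ladderState a' b' v (0, k)) = 0 := h.fst_apply_pow k
        exact Submodule.mem_comap.2 (h0 ▸ Submodule.zero_mem _)
      | succ j =>
        exact Submodule.mem_comap.2 (h.lower_fst_ladderState j k ▸
          Submodule.smul_mem _ _ (hmem j k))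
    · have hraise : q (ladderState q b' v (j, k)) = ladderState q b' v (j + 1, k) := by
        simp [ladderState, pow_succ']
      exact Submodule.mem_comap.2 (hraise ▸ hmem (j + 1) k)
    · cases k with
      | zero =>
        have h0 : q (ladderState a' b' v (j, 0)) = 0 := by
          simp only [ladderState, pow_zero, Module.End.one_apply]
          rw [← Module.End.mul_apply, (h.commute_snd.pow_right j).eq, Module.End.mul_apply,
            h.snd_vacuum, map_zero]
        exact Submodule.mem_comap.2 (h0 ▸ Submodule.zero_mem _)
      | succ k =>
        exact Submodule.mem_comap.2 (h.lower_snd_ladderState j k ▸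
          Submodule.smul_mem _ _ (hmem j k))
    · have hraise : q (ladderState a' q v (j, k)) = ladderState a' q v (j, k + 1) := by
        simp only [ladderState]
        rw [← Module.End.mul_apply, (h.commute_raise.symm.pow_right j).eq, Module.End.mul_apply,
          pow_succ' q, Module.End.mul_apply]
      exact Submodule.mem_comap.2 (hraise ▸ hmem j (k + 1))

end IsLadderPair

end Ladder

/-! ### Position and momentum operators on Schwartz functions -/

section SchwartzOps

open scoped LineDeriv ComplexConjugate

attribute [local instance] LieRing.ofAssociativeRing LieAlgebra.ofAssociativeAlgebra

lemma hasTemperateGrowth_coord (j : Fin 2) :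
    (fun x : Plane => ((x j : ℝ) : ℂ)).HasTemperateGrowth :=
  (Complex.ofRealCLM.comp (EuclideanSpace.proj (𝕜 := ℝ) j)).hasTemperateGrowth

/-- Multiplication by the coordinate `x j`, on Schwartz functions. -/
noncomputable def posOp (j : Fin 2) : Module.End ℂ 𝓢(Plane, ℂ) :=
  (SchwartzMap.smulLeftCLM ℂ fun x : Plane => ((x j : ℝ) : ℂ)).toLinearMap

/-- The partial derivative `∂/∂x_{j+1}`, on Schwartz functions. -/
noncomputable def derivOp (j : Fin 2) : Module.End ℂ 𝓢(Plane, ℂ) :=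
  (LineDeriv.lineDerivOpCLM ℂ 𝓢(Plane, ℂ) (EuclideanSpace.single j (1 : ℝ))).toLinearMap

lemma posOp_apply (j : Fin 2) (f : 𝓢(Plane, ℂ)) (x : Plane) : posOp j f x = (x j : ℂ) * f x :=
  SchwartzMap.smulLeftCLM_apply_apply (hasTemperateGrowth_coord j) f x

lemma derivOp_apply (j : Fin 2) (f : 𝓢(Plane, ℂ)) (x : Plane) :
    derivOp j f x = partialDeriv j f x := rfl

lemma derivOp_posOp_apply (j k : Fin 2) (f : 𝓢(Plane, ℂ)) (x : Plane) :
    derivOp j (posOp k f) x = (x k : ℂ) * derivOp j f x + if j = k then f x else 0 := by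
  have hcoord : HasFDerivAt (fun x : Plane => ((x k : ℝ) : ℂ))
      (Complex.ofRealCLM.comp (EuclideanSpace.proj (𝕜 := ℝ) k)) x :=
    (Complex.ofRealCLM.comp (EuclideanSpace.proj (𝕜 := ℝ) k)).hasFDerivAt
  have hprod : HasFDerivAt (posOp k f) _ x :=
    (hcoord.mul (f.hasFDerivAt x)).congr_of_eventuallyEq (.of_forall (posOp_apply k f))
  rw [derivOp_apply, derivOp_apply, partialDeriv, partialDeriv, hprod.fderiv]
  by_cases h : j = k
  · subst h; simp
  · simp [h, Ne.symm h]

lemma lie_posOp_posOp (j k : Fin 2) : ⁅posOp j, posOp k⁆ = 0 := by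
  rw [Ring.lie_def, sub_eq_zero]
  ext f x
  simp only [Module.End.mul_apply, posOp_apply]
  ring

lemma lie_derivOp_derivOp (j k : Fin 2) : ⁅derivOp j, derivOp k⁆ = 0 := by
  rw [Ring.lie_def, sub_eq_zero]
  ext f x
  have hsecond : ∀ j k : Fin 2, derivOp j (derivOp k f) x =
      fderiv ℝ (fderiv ℝ f) x (EuclideanSpace.single j 1) (EuclideanSpace.single k 1) := by
    intro j k
    have hdiff : DifferentiableAt ℝ (fderiv ℝ f) x :=
      (((f.smooth 2).fderiv_right (m := 1) (by norm_num)).differentiable (by simp)) x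
    change fderiv ℝ (fun y => fderiv ℝ f y (EuclideanSpace.single k 1)) x _ = _
    rw [fderiv_clm_apply hdiff (differentiableAt_const _)]
    simp
  rw [Module.End.mul_apply, Module.End.mul_apply, hsecond, hsecond]
  exact ((f.smooth 2).contDiffAt.isSymmSndFDerivAt (by simp)).eq _ _

lemma lie_derivOp_posOp (j k : Fin 2) :
    ⁅derivOp j, posOp k⁆ = (if j = k then (1 : ℂ) else 0) • 1 := by
  ext f x
  change derivOp j (posOp k f) x - posOp k (derivOp j f) x = (if j = k then (1 : ℂ) else 0) * f x
  rw [derivOp_posOp_apply, posOp_apply, add_sub_cancel_left]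
  split_ifs <;> simp

/-- The embedding of Schwartz functions into `L²(ℝ²)`. -/
noncomputable def schwartzToL2 : 𝓢(Plane, ℂ) →ₗ[ℂ] L2Plane :=
  (SchwartzMap.toLpCLM ℂ ℂ 2 (volume : Measure Plane)).toLinearMap

lemma coeFn_schwartzToL2 (f : 𝓢(Plane, ℂ)) : schwartzToL2 f =ᵐ[volume] f :=
  f.coeFn_toLp 2 volume

lemma inner_schwartzToL2 (f g : 𝓢(Plane, ℂ)) :
    ⟪schwartzToL2 f, schwartzToL2 g⟫_ℂ = ∫ x, conj (f x) * g x := by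
  have h := SchwartzMap.inner_toL2_toL2_eq f g volume
  simp only [RCLike.inner_apply, mul_comm (g _)] at h
  exact h

lemma inner_posOp_left (j : Fin 2) (f g : 𝓢(Plane, ℂ)) :
    ⟪schwartzToL2 (posOp j f), schwartzToL2 g⟫_ℂ =
      ⟪schwartzToL2 f, schwartzToL2 (posOp j g)⟫_ℂ := by
  rw [inner_schwartzToL2, inner_schwartzToL2]
  congr 1
  ext x
  rw [posOp_apply, posOp_apply, map_mul, Complex.conj_ofReal]
  ring

lemma inner_derivOp_left (j : Fin 2) (f g : 𝓢(Plane, ℂ)) :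
    ⟪schwartzToL2 (derivOp j f), schwartzToL2 g⟫_ℂ =
      -⟪schwartzToL2 f, schwartzToL2 (derivOp j g)⟫_ℂ := by
  rw [inner_schwartzToL2, inner_schwartzToL2]
  have hparts := SchwartzMap.integral_bilinear_lineDerivOp_right_eq_neg_left (μ := volume) f g
    ((ContinuousLinearMap.mul ℝ ℂ) ∘L (Complex.conjCLE : ℂ →L[ℝ] ℂ)) (EuclideanSpace.single j 1)
  simp only [ContinuousLinearMap.comp_apply, ContinuousLinearMap.mul_apply'] at hparts
  exact (neg_eq_iff_eq_neg.2 hparts).symm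

/-- The magnetic momentum `π₁ = -i ∂/∂x₁ + B x₂ / 2`, on Schwartz functions. -/
noncomputable def magOp₁ (B : ℝ) : Module.End ℂ 𝓢(Plane, ℂ) :=
  (-Complex.I) • derivOp 0 + ((B / 2 : ℝ) : ℂ) • posOp 1

/-- The magnetic momentum `π₂ = -i ∂/∂x₂ - B x₁ / 2`, on Schwartz functions. -/
noncomputable def magOp₂ (B : ℝ) : Module.End ℂ 𝓢(Plane, ℂ) :=
  (-Complex.I) • derivOp 1 - ((B / 2 : ℝ) : ℂ) • posOp 0

/-- `H_B + V` for the oscillator potential `V`, on Schwartz functions. -/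
noncomputable def oscOp (B ω₁ ω₂ μ : ℝ) : Module.End ℂ 𝓢(Plane, ℂ) :=
  magOp₁ B * magOp₁ B + magOp₂ B * magOp₂ B + ((ω₁ ^ 2 : ℝ) : ℂ) • (posOp 0 * posOp 0)
    + ((ω₂ ^ 2 : ℝ) : ℂ) • (posOp 1 * posOp 1) - (μ : ℂ) • 1

/-- The linear combination `α₁ π₁ + α₂ π₂ + β₁ x₁ + β₂ x₂`. These span a space invariant under
commutation with `oscOp`, in which the ladder operators are found. -/
noncomputable def linOp (B : ℝ) (α₁ α₂ β₁ β₂ : ℂ) : Module.End ℂ 𝓢(Plane, ℂ) :=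
  α₁ • magOp₁ B + α₂ • magOp₂ B + β₁ • posOp 0 + β₂ • posOp 1

variable (B ω₁ ω₂ μ : ℝ) (α₁ α₂ β₁ β₂ : ℂ) (f g : 𝓢(Plane, ℂ))

lemma coe_magOp₁ : ⇑(magOp₁ B f) = magMomentum₁ B f := by
  ext x
  change -Complex.I * derivOp 0 f x + ((B / 2 : ℝ) : ℂ) * posOp 1 f x = _
  rw [posOp_apply, derivOp_apply, magMomentum₁]
  push_cast
  ring

lemma coe_magOp₂ : ⇑(magOp₂ B f) = magMomentum₂ B f := by
  ext x
  change -Complex.I * derivOp 1 f x - ((B / 2 : ℝ) : ℂ) * posOp 0 f x = _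
  rw [posOp_apply, derivOp_apply, magMomentum₂]
  push_cast
  ring

lemma coe_oscOp :
    ⇑(oscOp B ω₁ ω₂ μ f) = magSchrodingerExpr B (oscPotential ω₁ ω₂ μ) f := by
  ext x
  change magOp₁ B (magOp₁ B f) x + magOp₂ B (magOp₂ B f) x
    + ((ω₁ ^ 2 : ℝ) : ℂ) * posOp 0 (posOp 0 f) x + ((ω₂ ^ 2 : ℝ) : ℂ) * posOp 1 (posOp 1 f) x
    - (μ : ℂ) * f x = _
  simp only [coe_magOp₁, coe_magOp₂, posOp_apply, magSchrodingerExpr, oscPotential]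
  push_cast
  ring

lemma inner_magOp₁_left :
    ⟪schwartzToL2 (magOp₁ B f), schwartzToL2 g⟫_ℂ =
      ⟪schwartzToL2 f, schwartzToL2 (magOp₁ B g)⟫_ℂ := by
  simp only [magOp₁, LinearMap.add_apply, LinearMap.smul_apply, map_add, map_smul, inner_add_left,
    inner_add_right, inner_smul_left, inner_smul_right, inner_posOp_left, inner_derivOp_left,
    Complex.conj_ofReal]
  simp

lemma inner_magOp₂_left :
    ⟪schwartzToL2 (magOp₂ B f), schwartzToL2 g⟫_ℂ =
      ⟪schwartzToL2 f, schwartzToL2 (magOp₂ B g)⟫_ℂ := by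
  simp only [magOp₂, LinearMap.sub_apply, LinearMap.smul_apply, map_sub, map_smul, inner_sub_left,
    inner_sub_right, inner_smul_left, inner_smul_right, inner_posOp_left, inner_derivOp_left,
    Complex.conj_ofReal]
  simp

lemma inner_oscOp_left :
    ⟪schwartzToL2 (oscOp B ω₁ ω₂ μ f), schwartzToL2 g⟫_ℂ =
      ⟪schwartzToL2 f, schwartzToL2 (oscOp B ω₁ ω₂ μ g)⟫_ℂ := by
  simp only [oscOp, LinearMap.sub_apply, LinearMap.add_apply, LinearMap.smul_apply, map_sub,
    map_add, map_smul, inner_sub_left, inner_sub_right, inner_add_left, inner_add_right,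
    inner_smul_left, inner_smul_right, Module.End.mul_apply, Module.End.one_apply,
    inner_posOp_left, inner_magOp₁_left, inner_magOp₂_left, Complex.conj_ofReal]

lemma inner_linOp_left :
    ⟪schwartzToL2 (linOp B α₁ α₂ β₁ β₂ f), schwartzToL2 g⟫_ℂ =
      ⟪schwartzToL2 f, schwartzToL2 (linOp B (conj α₁) (conj α₂) (conj β₁) (conj β₂) g)⟫_ℂ := by
  simp only [linOp, LinearMap.add_apply, LinearMap.smul_apply, map_add, map_smul, inner_add_left,
    inner_add_right, inner_smul_left, inner_smul_right, inner_posOp_left, inner_magOp₁_left,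
    inner_magOp₂_left]

lemma lie_posOp_derivOp (j k : Fin 2) :
    ⁅posOp j, derivOp k⁆ = (if j = k then (-1 : ℂ) else 0) • 1 := by
  rw [← lie_skew, lie_derivOp_posOp]
  by_cases h : j = k
  · simp [h]
  · simp [h, Ne.symm h]

lemma lie_posOp_magOp₁ (j : Fin 2) :
    ⁅posOp j, magOp₁ B⁆ = (if j = 0 then Complex.I else 0) • 1 := by
  rw [magOp₁, lie_add, lie_smul, lie_smul, lie_posOp_derivOp, lie_posOp_posOp]
  split_ifs <;> simp

lemma lie_posOp_magOp₂ (j : Fin 2) :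
    ⁅posOp j, magOp₂ B⁆ = (if j = 1 then Complex.I else 0) • 1 := by
  rw [magOp₂, lie_sub, lie_smul, lie_smul, lie_posOp_derivOp, lie_posOp_posOp]
  split_ifs <;> simp

lemma lie_magOp₁_posOp (j : Fin 2) :
    ⁅magOp₁ B, posOp j⁆ = (if j = 0 then -Complex.I else 0) • 1 := by
  rw [← lie_skew, lie_posOp_magOp₁]
  split_ifs <;> simp

lemma lie_magOp₂_posOp (j : Fin 2) :
    ⁅magOp₂ B, posOp j⁆ = (if j = 1 then -Complex.I else 0) • 1 := by
  rw [← lie_skew, lie_posOp_magOp₂]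
  split_ifs <;> simp

lemma lie_magOp₁_magOp₂ : ⁅magOp₁ B, magOp₂ B⁆ = (Complex.I * B) • 1 := by
  simp only [magOp₁, magOp₂, lie_sub, add_lie, smul_lie, lie_smul, lie_posOp_derivOp,
    lie_derivOp_posOp, lie_posOp_posOp, lie_derivOp_derivOp, smul_smul, if_true, smul_zero,
    zero_add, add_zero, Complex.ofReal_div, Complex.ofReal_ofNat]
  module

lemma lie_magOp₂_magOp₁ : ⁅magOp₂ B, magOp₁ B⁆ = (-(Complex.I * B)) • 1 := by
  rw [← lie_skew, lie_magOp₁_magOp₂, neg_smul]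

lemma lie_magOp₁_linOp :
    ⁅magOp₁ B, linOp B α₁ α₂ β₁ β₂⁆ = (Complex.I * (B * α₂ - β₁)) • 1 := by
  simp only [linOp, lie_add, lie_smul, lie_self, lie_magOp₁_magOp₂, lie_magOp₁_posOp, if_true,
    one_ne_zero, if_false]
  module

lemma lie_magOp₂_linOp :
    ⁅magOp₂ B, linOp B α₁ α₂ β₁ β₂⁆ = (-Complex.I * (B * α₁ + β₂)) • 1 := by
  simp only [linOp, lie_add, lie_smul, lie_self, lie_magOp₂_magOp₁, lie_magOp₂_posOp, if_true,
    zero_ne_one, if_false]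
  module

lemma lie_posOp_zero_linOp : ⁅posOp 0, linOp B α₁ α₂ β₁ β₂⁆ = (Complex.I * α₁) • 1 := by
  simp only [linOp, lie_add, lie_smul, lie_posOp_posOp, lie_posOp_magOp₁, lie_posOp_magOp₂,
    if_true, zero_ne_one, if_false]
  module

lemma lie_posOp_one_linOp : ⁅posOp 1, linOp B α₁ α₂ β₁ β₂⁆ = (Complex.I * α₂) • 1 := by
  simp only [linOp, lie_add, lie_smul, lie_posOp_posOp, lie_posOp_magOp₁, lie_posOp_magOp₂,
    if_true, one_ne_zero, if_false]
  module

lemma lie_linOp_linOp (α₁' α₂' β₁' β₂' : ℂ) :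
    ⁅linOp B α₁ α₂ β₁ β₂, linOp B α₁' α₂' β₁' β₂'⁆ =
      (Complex.I * (B * (α₁ * α₂' - α₂ * α₁') - α₁ * β₁' - α₂ * β₂' + β₁ * α₁' + β₂ * α₂')) •
        1 := by
  rw [linOp, add_lie, add_lie, add_lie, smul_lie, smul_lie, smul_lie, smul_lie,
    lie_magOp₁_linOp, lie_magOp₂_linOp, lie_posOp_zero_linOp, lie_posOp_one_linOp]
  module

lemma lie_mul_self_of_lie_eq_smul_one {A : Type*} [Ring A] [Algebra ℂ A] {p q : A} {s : ℂ}
    (h : ⁅p, q⁆ = s • 1) : ⁅p * p, q⁆ = (2 * s) • p := by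
  have hleibniz : ⁅p * p, q⁆ = p * ⁅p, q⁆ + ⁅p, q⁆ * p := by
    simp only [Ring.lie_def]
    noncomm_ring
  rw [hleibniz, h, mul_smul_comm, smul_mul_assoc, mul_one, one_mul]
  module

lemma lie_oscOp_linOp :
    ⁅oscOp B ω₁ ω₂ μ, linOp B α₁ α₂ β₁ β₂⁆ =
      linOp B (2 * Complex.I * (B * α₂ - β₁)) (-2 * Complex.I * (B * α₁ + β₂))
        (2 * Complex.I * ω₁ ^ 2 * α₁) (2 * Complex.I * ω₂ ^ 2 * α₂) := by
  have hone : ⁅(1 : Module.End ℂ 𝓢(Plane, ℂ)), linOp B α₁ α₂ β₁ β₂⁆ = 0 := by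
    simp [Ring.lie_def]
  rw [oscOp, sub_lie, add_lie, add_lie, add_lie, smul_lie, smul_lie, smul_lie, hone,
    lie_mul_self_of_lie_eq_smul_one (lie_magOp₁_linOp B α₁ α₂ β₁ β₂),
    lie_mul_self_of_lie_eq_smul_one (lie_magOp₂_linOp B α₁ α₂ β₁ β₂),
    lie_mul_self_of_lie_eq_smul_one (lie_posOp_zero_linOp B α₁ α₂ β₁ β₂),
    lie_mul_self_of_lie_eq_smul_one (lie_posOp_one_linOp B α₁ α₂ β₁ β₂), linOp]
  push_cast
  module

end SchwartzOps

/-! ### Gaussian Schwartz functions -/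

section Gaussian

variable {E : Type*} [NormedAddCommGroup E] [NormedSpace ℝ E]

lemma norm_iteratedFDeriv_cexp (n : ℕ) (z : ℂ) :
    ‖iteratedFDeriv ℝ n Complex.exp z‖ = ‖Complex.exp z‖ := by
  have hsmooth : ContDiffAt ℂ n Complex.exp z := Complex.contDiff_exp.contDiffAt
  rw [← hsmooth.restrictScalars_iteratedFDeriv (𝕜 := ℝ) (𝕜' := ℂ), Function.comp_apply,
    ContinuousMultilinearMap.norm_restrictScalars, norm_iteratedFDeriv_eq_norm_iteratedDeriv,
    iteratedDeriv_eq_iterate, Complex.iter_deriv_exp]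

lemma exists_norm_iteratedFDeriv_cexp_comp_le {φ : E → ℂ} (hφ : φ.HasTemperateGrowth) (n : ℕ) :
    ∃ (k : ℕ) (C : ℝ), 0 ≤ C ∧ ∀ x, ‖iteratedFDeriv ℝ n (fun x => Complex.exp (φ x)) x‖ ≤
      C * (1 + ‖x‖) ^ k * ‖Complex.exp (φ x)‖ := by
  obtain ⟨k, C, hC, hbound⟩ := hφ.norm_iteratedFDeriv_le_uniform n
  refine ⟨k * n, n.factorial * (1 + C) ^ n, by positivity, fun x => ?_⟩
  have hinner : ∀ i, 1 ≤ i → i ≤ n →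
      ‖iteratedFDeriv ℝ i φ x‖ ≤ ((1 + C) * (1 + ‖x‖) ^ k) ^ i := by
    intro i hi hi'
    calc _ ≤ C * (1 + ‖x‖) ^ k := hbound i hi' x
      _ ≤ (1 + C) * (1 + ‖x‖) ^ k := by gcongr; simp
      _ ≤ _ := by
        apply le_self_pow₀ (one_le_mul_of_one_le_of_one_le (by simp [hC]) (by simp [one_le_pow₀]))
        lia
  refine (norm_iteratedFDeriv_comp_le (Complex.contDiff_exp (n := ∞)) hφ.1
    (by exact_mod_cast le_top) x (fun i _ => (norm_iteratedFDeriv_cexp i _).le) hinner).trans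
    (le_of_eq ?_)
  rw [mul_pow, ← pow_mul]
  ring

lemma one_add_pow_mul_exp_neg_sq_le {b : ℝ} (hb : 0 < b) (m : ℕ) {r : ℝ} (hr : 0 ≤ r) :
    (1 + r) ^ m * Real.exp (-(b * r ^ 2)) ≤ Real.exp (m ^ 2 / (4 * b)) := by
  have hpow : (1 + r) ^ m ≤ Real.exp (m * r) := by
    rw [Real.exp_nat_mul]
    gcongr
    linarith [Real.add_one_le_exp r]
  calc _ ≤ Real.exp (m * r) * Real.exp (-(b * r ^ 2)) := by gcongr
    _ = Real.exp (m * r + -(b * r ^ 2)) := (Real.exp_add _ _).symm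
    _ ≤ _ := by
      rw [Real.exp_le_exp, le_div_iff₀ (by positivity)]
      nlinarith [sq_nonneg (m - 2 * b * r)]

/-- The Schwartz function `exp φ`, for an exponent `φ` of temperate growth whose real part is at
most a negative multiple of the squared norm. -/
noncomputable def expSchwartz {φ : E → ℂ} (hφ : φ.HasTemperateGrowth) {b : ℝ} (hb : 0 < b)
    (hle : ∀ x, (φ x).re ≤ -(b * ‖x‖ ^ 2)) : 𝓢(E, ℂ) where
  toFun x := Complex.exp (φ x)
  smooth' := Complex.contDiff_exp.comp hφ.1
  decay' k n := by
    obtain ⟨l, C, hC, hbound⟩ := exists_norm_iteratedFDeriv_cexp_comp_le hφ n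
    refine ⟨C * Real.exp ((k + l : ℕ) ^ 2 / (4 * b)), fun x => ?_⟩
    have hexp : ‖Complex.exp (φ x)‖ ≤ Real.exp (-(b * ‖x‖ ^ 2)) := by
      rw [Complex.norm_exp]
      exact Real.exp_le_exp.2 (hle x)
    calc _ ≤ (1 + ‖x‖) ^ k * (C * (1 + ‖x‖) ^ l * Real.exp (-(b * ‖x‖ ^ 2))) := by
          refine mul_le_mul ?_ ((hbound x).trans (by gcongr)) (norm_nonneg _) (by positivity)
          gcongr
          simp
      _ = C * ((1 + ‖x‖) ^ (k + l) * Real.exp (-(b * ‖x‖ ^ 2))) := by rw [pow_add]; ring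
      _ ≤ _ := by
          gcongr
          exact one_add_pow_mul_exp_neg_sq_le hb _ (norm_nonneg _)

lemma expSchwartz_apply {φ : E → ℂ} (hφ : φ.HasTemperateGrowth) {b : ℝ} (hb : 0 < b)
    (hle : ∀ x, (φ x).re ≤ -(b * ‖x‖ ^ 2)) (x : E) :
    expSchwartz hφ hb hle x = Complex.exp (φ x) := rfl

/-- The exponent `-(a x₁² + c x₂²) / 2 + i γ x₁ x₂` of a Gaussian with a phase. -/
noncomputable def gaussianExponent (a c γ : ℝ) (x : Plane) : ℂ :=
  Complex.I * (γ * (x 0 * x 1)) - (a * x 0 ^ 2 + c * x 1 ^ 2) / 2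

variable {a c : ℝ}

lemma hasTemperateGrowth_gaussianExponent (a c γ : ℝ) :
    (gaussianExponent a c γ).HasTemperateGrowth := by
  have hx := hasTemperateGrowth_coord
  have hconst (z : ℂ) := Function.HasTemperateGrowth.const (E := Plane) z
  exact ((hconst _).mul ((hconst _).mul ((hx 0).mul (hx 1)))).sub
    ((((hconst _).mul ((hx 0).pow 2)).add ((hconst _).mul ((hx 1).pow 2))).mul (hconst 2⁻¹))

lemma norm_sq_plane (x : Plane) : ‖x‖ ^ 2 = x 0 ^ 2 + x 1 ^ 2 := by
  rw [EuclideanSpace.norm_sq_eq]; simp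

lemma re_gaussianExponent_le (a c γ : ℝ) (x : Plane) :
    (gaussianExponent a c γ x).re ≤ -(min a c / 2 * ‖x‖ ^ 2) := by
  have hre : (gaussianExponent a c γ x).re = -((a * x 0 ^ 2 + c * x 1 ^ 2) / 2) := by
    have : gaussianExponent a c γ x = ((-((a * x 0 ^ 2 + c * x 1 ^ 2) / 2) : ℝ) : ℂ) +
        ((γ * (x 0 * x 1) : ℝ) : ℂ) * Complex.I := by
      rw [gaussianExponent]; push_cast; ring
    rw [this, Complex.add_re, Complex.ofReal_re, Complex.re_ofReal_mul, Complex.I_re, mul_zero,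
      add_zero]
  rw [hre, norm_sq_plane]
  have h0 := mul_le_mul_of_nonneg_right (min_le_left a c) (sq_nonneg (x 0))
  have h1 := mul_le_mul_of_nonneg_right (min_le_right a c) (sq_nonneg (x 1))
  linarith

/-- The Schwartz function `exp (-(a x₁² + c x₂²) / 2 + i γ x₁ x₂)`, the shape of the ground state
of a quadratic magnetic Hamiltonian in the symmetric gauge. -/
noncomputable def gaussianState (ha : 0 < a) (hc : 0 < c) (γ : ℝ) : 𝓢(Plane, ℂ) :=
  expSchwartz (hasTemperateGrowth_gaussianExponent a c γ) (half_pos (lt_min ha hc))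
    (re_gaussianExponent_le a c γ)

variable (ha : 0 < a) (hc : 0 < c) (γ : ℝ) (x : Plane)

lemma gaussianState_apply :
    gaussianState ha hc γ x =
      Complex.exp (Complex.I * (γ * (x 0 * x 1)) - (a * x 0 ^ 2 + c * x 1 ^ 2) / 2) := rfl

lemma gaussianState_ne_zero : gaussianState ha hc γ x ≠ 0 := Complex.exp_ne_zero _

lemma norm_gaussianState_le :
    ‖gaussianState ha hc γ x‖ ≤ Real.exp (-(min a c / 2 * ‖x‖ ^ 2)) :=
  (Complex.norm_exp _).trans_le (Real.exp_le_exp.2 (re_gaussianExponent_le a c γ x))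

lemma partialDeriv_gaussianState (j : Fin 2) :
    partialDeriv j (gaussianState ha hc γ) x =
      (if j = 0 then Complex.I * γ * x 1 - a * x 0 else Complex.I * γ * x 0 - c * x 1) *
        gaussianState ha hc γ x := by
  have hx : ∀ k : Fin 2, HasFDerivAt (fun x : Plane => ((x k : ℝ) : ℂ))
      (Complex.ofRealCLM.comp (EuclideanSpace.proj (𝕜 := ℝ) k)) x := fun k =>
    (Complex.ofRealCLM.comp (EuclideanSpace.proj (𝕜 := ℝ) k)).hasFDerivAt
  have hexponent := ((((hx 0).mul (hx 1)).const_mul (γ : ℂ)).const_mul Complex.I).sub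
    ((((((hx 0).pow 2).const_mul (a : ℂ)).add (((hx 1).pow 2).const_mul (c : ℂ)))).mul_const
      (2⁻¹ : ℂ))
  have hderiv : HasFDerivAt (gaussianState ha hc γ) _ x := hexponent.cexp
  rw [partialDeriv, hderiv.fderiv, gaussianState_apply, div_eq_mul_inv]
  fin_cases j <;> simp <;> ring_nf

end Gaussian

/-! ### Moments determine a function of Gaussian decay -/

section Density

open scoped FourierTransform ComplexConjugate

variable {E : Type*} [NormedAddCommGroup E] [InnerProductSpace ℝ E] [FiniteDimensional ℝ E]
  [MeasurableSpace E] [BorelSpace E]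

lemma ae_eq_zero_of_fourier_eq_zero {g : E → ℂ} (hg : Integrable g) (h : 𝓕 g = 0) :
    ∀ᵐ x, g x = 0 := by
  refine ae_eq_zero_of_integral_contDiff_smul_eq_zero hg.locallyIntegrable fun u hu hc => ?_
  have hc' : HasCompactSupport (fun x => (u x : ℂ)) := hc.comp_left Complex.ofReal_zero
  set ψ : 𝓢(E, ℂ) := hc'.toSchwartzMap (Complex.ofRealCLM.contDiff.comp hu)
  have hinv : 𝓕 (𝓕⁻ ψ : 𝓢(E, ℂ)) = ψ := FourierTransform.fourier_fourierInv_eq ψ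
  have hflip := VectorFourier.integral_fourierIntegral_smul_eq_flip (L := innerₗ E)
    (μ := volume) (ν := volume) Real.continuous_fourierChar continuous_inner
    (𝓕⁻ ψ : 𝓢(E, ℂ)).integrable hg
  have hzero : VectorFourier.fourierIntegral Real.fourierChar volume (innerₗ E) g = 0 := h
  simp only [flip_innerₗ, hzero, Pi.zero_apply, smul_zero, integral_zero] at hflip
  have hψ : ∫ x, ψ x • g x = 0 := by
    rw [← hinv]
    exact hflip
  simp_rw [Complex.real_smul]
  exact hψ

lemma hasSum_integral_moments {g : E → ℂ} (hg : AEStronglyMeasurable g volume)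
    (hint : ∀ r : ℝ, Integrable fun x => Real.exp (r * ‖x‖) * ‖g x‖) (w : E) :
    HasSum (fun n : ℕ => ∫ x, (-2 * Real.pi * Complex.I : ℂ) ^ n / n.factorial *
      (((⟪w, x⟫_ℝ : ℝ) : ℂ) ^ n * g x)) (𝓕 g w) := by
  have hnorm : ‖(-2 * Real.pi * Complex.I : ℂ)‖ = 2 * Real.pi := by
    simp [abs_of_pos Real.pi_pos]
  rw [Real.fourier_eq']
  refine hasSum_integral_of_dominated_convergence
    (fun n x => (2 * Real.pi * ‖w‖ * ‖x‖) ^ n / n.factorial * ‖g x‖) (fun n => ?_)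
    (fun n => .of_forall fun x => ?_)
    (.of_forall fun x => (Real.summable_pow_div_factorial _).mul_right _)
    ((hint (2 * Real.pi * ‖w‖)).congr (.of_forall fun x => ?_)) (.of_forall fun x => ?_)
  · exact (AEStronglyMeasurable.mul (Continuous.aestronglyMeasurable (by fun_prop)) hg).const_mul _
  · rw [norm_mul, norm_mul, norm_div, norm_pow, norm_pow, hnorm, Complex.norm_natCast,
      Complex.norm_real, ← mul_assoc, div_mul_eq_mul_div, ← mul_pow, mul_assoc _ ‖w‖]
    gcongr
    exact norm_inner_le_norm w x
  · simp only [tsum_mul_right, Real.exp_eq_exp_ℝ, NormedSpace.exp_eq_tsum_div]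
  · have hexp := (NormedSpace.expSeries_div_hasSum_exp
      (((-2 * Real.pi * ⟪x, w⟫_ℝ : ℝ) : ℂ) * Complex.I)).mul_right (g x)
    rw [← Complex.exp_eq_exp_ℂ] at hexp
    refine hexp.congr_fun fun n => ?_
    rw [real_inner_comm]
    push_cast
    ring

lemma ae_eq_zero_of_moments_eq_zero {g : E → ℂ} (hg : AEStronglyMeasurable g volume)
    (hint : ∀ r : ℝ, Integrable fun x => Real.exp (r * ‖x‖) * ‖g x‖)
    (h : ∀ (ξ : E) (n : ℕ), ∫ x, ((⟪ξ, x⟫_ℝ : ℝ) : ℂ) ^ n * g x = 0) : ∀ᵐ x, g x = 0 := by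
  have hgi : Integrable g := (integrable_norm_iff hg).1 (by simpa using hint 0)
  refine ae_eq_zero_of_fourier_eq_zero hgi (funext fun w => ?_)
  have hsum := hasSum_integral_moments hg hint w
  simp only [integral_const_mul, h, mul_zero] at hsum
  exact hsum.unique hasSum_zero

lemma integrable_exp_mul_norm_mul {g f : E → ℂ} {b : ℝ} (hb : 0 < b) (hg : Continuous g)
    (hle : ∀ x, ‖g x‖ ≤ Real.exp (-(b * ‖x‖ ^ 2))) (hf : MemLp f 2) (r : ℝ) :
    Integrable fun x => Real.exp (r * ‖x‖) * ‖g x * f x‖ := by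
  have hφ : (fun x : E => ((-(b / 2 * ‖x‖ ^ 2) : ℝ) : ℂ)).HasTemperateGrowth :=
    Complex.ofRealCLM.hasTemperateGrowth.comp
      ((Function.HasTemperateGrowth.const (b / 2)).mul
        (Function.hasTemperateGrowth_norm_sq E)).neg
  have hgauss := (expSchwartz hφ (half_pos hb) fun _ => (Complex.ofReal_re _).le).memLp 2 volume
  have hprod : MemLp (fun x => Real.exp (r * ‖x‖) * ‖g x‖) 2 (volume : Measure E) := by
    refine hgauss.of_le_mul (c := Real.exp (r ^ 2 / (2 * b)))
      (Continuous.aestronglyMeasurable (by fun_prop)) (.of_forall fun x => ?_)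
    rw [expSchwartz_apply, Complex.norm_exp, Complex.ofReal_re, ← Real.exp_add, norm_mul,
      norm_norm, Real.norm_of_nonneg (Real.exp_nonneg _)]
    have hsq : r ^ 2 / (2 * b) + b / 2 * ‖x‖ ^ 2 - r * ‖x‖ = (r - b * ‖x‖) ^ 2 / (2 * b) := by
      field_simp
      ring
    have hnonneg : 0 ≤ (r - b * ‖x‖) ^ 2 / (2 * b) := by positivity
    calc _ ≤ Real.exp (r * ‖x‖) * Real.exp (-(b * ‖x‖ ^ 2)) := by gcongr; exact hle x
      _ = Real.exp (r * ‖x‖ + -(b * ‖x‖ ^ 2)) := (Real.exp_add _ _).symm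
      _ ≤ _ := Real.exp_le_exp.2 (by linarith)
  refine (hprod.integrable_mul hf.norm).congr (.of_forall fun x => ?_)
  simp [mul_assoc]

lemma integral_moment_eq_zero {W : Submodule ℂ 𝓢(Plane, ℂ)}
    (hW : ∀ j, W ≤ W.comap (posOp j)) {f : L2Plane} (hf : ∀ u ∈ W, ⟪schwartzToL2 u, f⟫_ℂ = 0)
    {g : 𝓢(Plane, ℂ)} (hg : g ∈ W) (ξ : Plane) (n : ℕ) :
    ∫ x, ((⟪ξ, x⟫_ℝ : ℝ) : ℂ) ^ n * (conj (g x) * f x) = 0 := by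
  set q : Module.End ℂ 𝓢(Plane, ℂ) := (ξ 0 : ℂ) • posOp 0 + (ξ 1 : ℂ) • posOp 1
  have hq : ∀ u x, q u x = ((⟪ξ, x⟫_ℝ : ℝ) : ℂ) * u x := by
    intro u x
    change (ξ 0 : ℂ) * posOp 0 u x + (ξ 1 : ℂ) * posOp 1 u x = _
    rw [posOp_apply, posOp_apply, PiLp.inner_apply]
    simp only [Fin.sum_univ_two, RCLike.inner_apply, conj_trivial]
    push_cast
    ring
  have hpow : (q ^ n) g ∈ W ∧ ∀ x, (q ^ n) g x = ((⟪ξ, x⟫_ℝ : ℝ) : ℂ) ^ n * g x := by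
    induction n with
    | zero => exact ⟨by simpa using hg, fun x => by simp⟩
    | succ n ih =>
      rw [pow_succ', Module.End.mul_apply]
      refine ⟨W.add_mem (W.smul_mem _ (hW 0 ih.1)) (W.smul_mem _ (hW 1 ih.1)), fun x => ?_⟩
      rw [hq, ih.2]
      ring
  rw [← hf _ hpow.1, L2.inner_def]
  refine integral_congr_ae ?_
  filter_upwards [coeFn_schwartzToL2 ((q ^ n) g)] with x hx
  rw [hx, hpow.2, RCLike.inner_apply, map_mul, map_pow, Complex.conj_ofReal]
  ring

theorem eq_zero_of_inner_eq_zero_of_gaussian_mem {W : Submodule ℂ 𝓢(Plane, ℂ)}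
    (hW : ∀ j, W ≤ W.comap (posOp j)) {g : 𝓢(Plane, ℂ)} (hg : g ∈ W) (hne : ∀ x, g x ≠ 0)
    {b : ℝ} (hb : 0 < b) (hle : ∀ x, ‖g x‖ ≤ Real.exp (-(b * ‖x‖ ^ 2))) {f : L2Plane}
    (hf : ∀ u ∈ W, ⟪schwartzToL2 u, f⟫_ℂ = 0) : f = 0 := by
  have hcont : Continuous fun x => conj (g x) := Complex.continuous_conj.comp g.continuous
  have hint := integrable_exp_mul_norm_mul hb hcont
    (fun x => (RCLike.norm_conj _).trans_le (hle x)) (Lp.memLp f)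
  have hzero := ae_eq_zero_of_moments_eq_zero
    (hcont.aestronglyMeasurable.mul (Lp.aestronglyMeasurable f)) hint
    (integral_moment_eq_zero hW hf hg)
  rw [Lp.eq_zero_iff_ae_eq_zero]
  filter_upwards [hzero] with x hx
  exact (mul_eq_zero.1 hx).resolve_left ((map_ne_zero _).2 (hne x))

end Density

/-! ### Ladder operators and ground state of the magnetic oscillator -/

section NormalFrequencies

open scoped ComplexConjugate

attribute [local instance] LieRing.ofAssociativeRing LieAlgebra.ofAssociativeAlgebra

/-- `ν` and `ν'` are the two normal frequencies of the magnetic oscillator: the positive roots,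
assumed distinct, of `(t² - ω₁²) (t² - ω₂²) = B² t²`. The two symmetric equations between them make
the roles of `ν` and `ν'` interchangeable. -/
structure IsFreqPair (B ω₁ ω₂ ν ν' : ℝ) : Prop where
  field_pos : 0 < B
  fst_pos : 0 < ω₁
  snd_pos : 0 < ω₂
  freq_pos : 0 < ν
  freq_pos' : 0 < ν'
  ne : ν ≠ ν'
  mul_eq : ν * ν' = ω₁ * ω₂
  sq_add_sq : ν ^ 2 + ν' ^ 2 = ω₁ ^ 2 + ω₂ ^ 2 + B ^ 2

/-- The annihilation operator of frequency `ν` (not normalized): the eigenvector, for the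
eigenvalue `-2ν`, of commutation with `oscOp`. -/
noncomputable def lowerOp (B ω₁ ν : ℝ) : Module.End ℂ 𝓢(Plane, ℂ) :=
  linOp B (B * ν) (Complex.I * (ν ^ 2 - ω₁ ^ 2)) (-(Complex.I * (ω₁ ^ 2 * B)))
    (ν * (ν ^ 2 - ω₁ ^ 2) - B ^ 2 * ν)

/-- The creation operator of frequency `ν` (not normalized): the adjoint of `lowerOp`. -/
noncomputable def raiseOp (B ω₁ ν : ℝ) : Module.End ℂ 𝓢(Plane, ℂ) :=
  linOp B (B * ν) (-(Complex.I * (ν ^ 2 - ω₁ ^ 2))) (Complex.I * (ω₁ ^ 2 * B))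
    (ν * (ν ^ 2 - ω₁ ^ 2) - B ^ 2 * ν)

/-- The scalar by which the commutator of `lowerOp` and `raiseOp` acts. -/
noncomputable def ladderConst (B ω₁ ν : ℝ) : ℝ :=
  2 * B ^ 2 * ν ^ 3 + 2 * ((ν ^ 2 - ω₁ ^ 2) * (ν * (ν ^ 2 - ω₁ ^ 2) - B ^ 2 * ν))

lemma smul_linOp (B : ℝ) (c α₁ α₂ β₁ β₂ : ℂ) :
    c • linOp B α₁ α₂ β₁ β₂ = linOp B (c * α₁) (c * α₂) (c * β₁) (c * β₂) := by
  simp only [linOp]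
  module

lemma lie_lowerOp_raiseOp (B ω₁ ν : ℝ) :
    ⁅lowerOp B ω₁ ν, raiseOp B ω₁ ν⁆ = (ladderConst B ω₁ ν : ℂ) • 1 := by
  rw [lowerOp, raiseOp, lie_linOp_linOp, ladderConst]
  congr 1
  push_cast
  linear_combination (-2 * (B : ℂ) ^ 2 * ν * ω₁ ^ 2 - 2 * B ^ 2 * ν * (ν ^ 2 - ω₁ ^ 2)
    - 2 * (ν ^ 2 - ω₁ ^ 2) * (ν * (ν ^ 2 - ω₁ ^ 2) - B ^ 2 * ν)) * Complex.I_sq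

lemma inner_lowerOp_left (B ω₁ ν : ℝ) (f g : 𝓢(Plane, ℂ)) :
    ⟪schwartzToL2 (lowerOp B ω₁ ν f), schwartzToL2 g⟫_ℂ =
      ⟪schwartzToL2 f, schwartzToL2 (raiseOp B ω₁ ν g)⟫_ℂ := by
  rw [lowerOp, inner_linOp_left, raiseOp]
  simp

namespace IsFreqPair

variable {B ω₁ ω₂ ν ν' : ℝ} (h : IsFreqPair B ω₁ ω₂ ν ν')

include h

lemma symm : IsFreqPair B ω₁ ω₂ ν' ν where
  __ := h
  freq_pos := h.freq_pos'
  freq_pos' := h.freq_pos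
  mul_eq := by rw [mul_comm, h.mul_eq]
  sq_add_sq := by rw [add_comm, h.sq_add_sq]
  ne := h.ne.symm

lemma characteristic_eq : (ν ^ 2 - ω₁ ^ 2) * (ν ^ 2 - ω₂ ^ 2) = B ^ 2 * ν ^ 2 := by
  linear_combination ν ^ 2 * h.sq_add_sq - (ν * ν' + ω₁ * ω₂) * h.mul_eq

lemma sq_sub_mul_sq_sub : (ν ^ 2 - ω₁ ^ 2) * (ν' ^ 2 - ω₁ ^ 2) = -(B ^ 2 * ω₁ ^ 2) := by
  linear_combination (ν * ν' + ω₁ * ω₂) * h.mul_eq - ω₁ ^ 2 * h.sq_add_sq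

lemma sq_sub_sq_ne_zero : ν ^ 2 - ν' ^ 2 ≠ 0 := by
  rw [sq_sub_sq]
  exact mul_ne_zero (add_pos h.freq_pos h.freq_pos').ne' (sub_ne_zero.2 h.ne)

lemma add_sq : (ν + ν') ^ 2 = (ω₁ + ω₂) ^ 2 + B ^ 2 := by
  linear_combination h.sq_add_sq + 2 * h.mul_eq

lemma ladderConst_pos : 0 < ladderConst B ω₁ ν := by
  have hB := h.field_pos
  have hν := h.freq_pos
  have hmul : ν * ((ν ^ 2 - ω₁ ^ 2) * (ν * (ν ^ 2 - ω₁ ^ 2) - B ^ 2 * ν)) =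
      ω₂ ^ 2 * (ν ^ 2 - ω₁ ^ 2) ^ 2 := by
    linear_combination (ν ^ 2 - ω₁ ^ 2) * h.characteristic_eq
  have hnonneg : 0 ≤ (ν ^ 2 - ω₁ ^ 2) * (ν * (ν ^ 2 - ω₁ ^ 2) - B ^ 2 * ν) :=
    nonneg_of_mul_nonneg_right (hmul ▸ by positivity) hν
  have hpos : 0 < 2 * B ^ 2 * ν ^ 3 := by positivity
  rw [ladderConst]
  linarith

lemma commute_raiseOp_raiseOp : Commute (raiseOp B ω₁ ν) (raiseOp B ω₁ ν') := by
  have hmul : ((ν : ℂ) ^ 2 - ω₁ ^ 2) * (ν' ^ 2 - ω₁ ^ 2) = -(B ^ 2 * ω₁ ^ 2) :=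
    mod_cast h.sq_sub_mul_sq_sub
  rw [commute_iff_lie_eq, raiseOp, raiseOp, lie_linOp_linOp]
  convert zero_smul ℂ _ using 2
  linear_combination (-Complex.I ^ 2 * (ν - ν')) * hmul

lemma commute_lowerOp_raiseOp : Commute (lowerOp B ω₁ ν) (raiseOp B ω₁ ν') := by
  have hmul : ((ν : ℂ) ^ 2 - ω₁ ^ 2) * (ν' ^ 2 - ω₁ ^ 2) = -(B ^ 2 * ω₁ ^ 2) :=
    mod_cast h.sq_sub_mul_sq_sub
  rw [commute_iff_lie_eq, lowerOp, raiseOp, lie_linOp_linOp]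
  convert zero_smul ℂ _ using 2
  linear_combination (-Complex.I ^ 2 * (ν + ν')) * hmul

lemma lie_oscOp_raiseOp (μ : ℝ) :
    ⁅oscOp B ω₁ ω₂ μ, raiseOp B ω₁ ν⁆ = (2 * ν : ℂ) • raiseOp B ω₁ ν := by
  have hchar : ((ν : ℂ) ^ 2 - ω₁ ^ 2) * (ν ^ 2 - ω₂ ^ 2) = B ^ 2 * ν ^ 2 :=
    mod_cast h.characteristic_eq
  rw [raiseOp, lie_oscOp_linOp, smul_linOp]
  congr 1
  · linear_combination (-2 * (B : ℂ) * ν ^ 2) * Complex.I_sq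
  · ring
  · ring
  · linear_combination (-2 * (ω₂ : ℂ) ^ 2 * (ν ^ 2 - ω₁ ^ 2)) * Complex.I_sq - 2 * hchar

end IsFreqPair

end NormalFrequencies

section GroundState

attribute [local instance] LieRing.ofAssociativeRing LieAlgebra.ofAssociativeAlgebra

lemma apply_apply_of_lie_eq_smul_one {V : Type*} [AddCommGroup V] [Module ℂ V]
    {p q : Module.End ℂ V} {s : ℂ} (h : ⁅p, q⁆ = s • 1) (v : V) : p (q v) = q (p v) + s • v := by
  have hv := congrArg (fun r : Module.End ℂ V => r v) h
  exact sub_eq_iff_eq_add'.1 hv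

variable (B : ℝ) {a c : ℝ} (ha : 0 < a) (hc : 0 < c) (γ : ℝ)

lemma magOp₁_gaussianState : magOp₁ B (gaussianState ha hc γ) =
    (Complex.I * a) • posOp 0 (gaussianState ha hc γ) +
      (γ + B / 2 : ℂ) • posOp 1 (gaussianState ha hc γ) := by
  ext x
  change _ = Complex.I * a * posOp 0 (gaussianState ha hc γ) x +
    (γ + B / 2 : ℂ) * posOp 1 (gaussianState ha hc γ) x
  rw [coe_magOp₁, magMomentum₁, partialDeriv_gaussianState, posOp_apply, posOp_apply, if_pos rfl]
  push_cast
  linear_combination (-(γ : ℂ) * x 1 * gaussianState ha hc γ x) * Complex.I_sq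

lemma magOp₂_gaussianState : magOp₂ B (gaussianState ha hc γ) =
    (γ - B / 2 : ℂ) • posOp 0 (gaussianState ha hc γ) +
      (Complex.I * c) • posOp 1 (gaussianState ha hc γ) := by
  ext x
  change _ = (γ - B / 2 : ℂ) * posOp 0 (gaussianState ha hc γ) x +
    Complex.I * c * posOp 1 (gaussianState ha hc γ) x
  rw [coe_magOp₂, magMomentum₂, partialDeriv_gaussianState, posOp_apply, posOp_apply,
    if_neg one_ne_zero]
  push_cast
  linear_combination (-(γ : ℂ) * x 0 * gaussianState ha hc γ x) * Complex.I_sq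

lemma posOp_one_posOp_zero (f : 𝓢(Plane, ℂ)) : posOp 1 (posOp 0 f) = posOp 0 (posOp 1 f) := by
  have h := apply_apply_of_lie_eq_smul_one ((lie_posOp_posOp 1 0).trans (zero_smul ℂ 1).symm) f
  rwa [zero_smul, add_zero] at h

lemma magOp₁_magOp₁_gaussianState : magOp₁ B (magOp₁ B (gaussianState ha hc γ)) =
    (a : ℂ) • gaussianState ha hc γ
      - (a ^ 2 : ℂ) • posOp 0 (posOp 0 (gaussianState ha hc γ))
      + (2 * Complex.I * a * (γ + B / 2)) • posOp 0 (posOp 1 (gaussianState ha hc γ))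
      + ((γ + B / 2) ^ 2 : ℂ) • posOp 1 (posOp 1 (gaussianState ha hc γ)) := by
  have hswap (j : Fin 2) :=
    apply_apply_of_lie_eq_smul_one (lie_magOp₁_posOp B j) (gaussianState ha hc γ)
  have hgauss := magOp₁_gaussianState B ha hc γ
  simp only [hgauss, map_add, map_smul, hswap, posOp_one_posOp_zero, if_true, one_ne_zero,
    if_false, smul_add, smul_smul]
  linear_combination (norm := module)
    Complex.I_sq • ((a ^ 2 : ℂ) • posOp 0 (posOp 0 (gaussianState ha hc γ))
      - (a : ℂ) • gaussianState ha hc γ)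

lemma magOp₂_magOp₂_gaussianState : magOp₂ B (magOp₂ B (gaussianState ha hc γ)) =
    (c : ℂ) • gaussianState ha hc γ
      + ((γ - B / 2) ^ 2 : ℂ) • posOp 0 (posOp 0 (gaussianState ha hc γ))
      + (2 * Complex.I * c * (γ - B / 2)) • posOp 0 (posOp 1 (gaussianState ha hc γ))
      - (c ^ 2 : ℂ) • posOp 1 (posOp 1 (gaussianState ha hc γ)) := by
  have hswap (j : Fin 2) :=
    apply_apply_of_lie_eq_smul_one (lie_magOp₂_posOp B j) (gaussianState ha hc γ)
  have hgauss := magOp₂_gaussianState B ha hc γ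
  simp only [hgauss, map_add, map_smul, hswap, posOp_one_posOp_zero, if_true, zero_ne_one,
    if_false, smul_add, smul_smul]
  linear_combination (norm := module)
    Complex.I_sq • ((c ^ 2 : ℂ) • posOp 1 (posOp 1 (gaussianState ha hc γ))
      - (c : ℂ) • gaussianState ha hc γ)

lemma linOp_gaussianState_eq_zero {α₁ α₂ β₁ β₂ : ℂ}
    (h₀ : α₁ * (Complex.I * a) + α₂ * (γ - B / 2) + β₁ = 0)
    (h₁ : α₁ * (γ + B / 2) + α₂ * (Complex.I * c) + β₂ = 0) :
    linOp B α₁ α₂ β₁ β₂ (gaussianState ha hc γ) = 0 := by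
  simp only [linOp, LinearMap.add_apply, LinearMap.smul_apply]
  rw [magOp₁_gaussianState, magOp₂_gaussianState, eq_neg_of_add_eq_zero_right h₀,
    eq_neg_of_add_eq_zero_right h₁]
  module

lemma oscOp_gaussianState {ω₁ ω₂ : ℝ} (μ : ℝ) (h₀ : a ^ 2 = ω₁ ^ 2 + (γ - B / 2) ^ 2)
    (h₁ : c ^ 2 = ω₂ ^ 2 + (γ + B / 2) ^ 2) (h₂ : a * (γ + B / 2) + c * (γ - B / 2) = 0) :
    oscOp B ω₁ ω₂ μ (gaussianState ha hc γ) =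
      ((a + c - μ : ℝ) : ℂ) • gaussianState ha hc γ := by
  replace h₀ : (a : ℂ) ^ 2 = ω₁ ^ 2 + (γ - B / 2) ^ 2 := mod_cast h₀
  replace h₁ : (c : ℂ) ^ 2 = ω₂ ^ 2 + (γ + B / 2) ^ 2 := mod_cast h₁
  replace h₂ : (a : ℂ) * (γ + B / 2) + c * (γ - B / 2) = 0 := mod_cast h₂
  simp only [oscOp, LinearMap.sub_apply, LinearMap.add_apply, LinearMap.smul_apply,
    Module.End.mul_apply, Module.End.one_apply, magOp₁_magOp₁_gaussianState,
    magOp₂_magOp₂_gaussianState]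
  push_cast
  linear_combination (norm := module)
    (2 * Complex.I * h₂) • posOp 0 (posOp 1 (gaussianState ha hc γ))
      - h₀ • posOp 0 (posOp 0 (gaussianState ha hc γ))
      - h₁ • posOp 1 (posOp 1 (gaussianState ha hc γ))

end GroundState

/-! ### Spectrum of the magnetic oscillator -/

section Spectrum

attribute [local instance] LieRing.ofAssociativeRing LieAlgebra.ofAssociativeAlgebra

namespace IsFreqPair

variable {B ω₁ ω₂ ν ν' : ℝ} (h : IsFreqPair B ω₁ ω₂ ν ν')

include h

lemma groundWidth_fst_pos : 0 < (ν + ν') * (ω₁ / (ω₁ + ω₂)) :=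
  mul_pos (add_pos h.freq_pos h.freq_pos') (div_pos h.fst_pos (add_pos h.fst_pos h.snd_pos))

lemma groundWidth_snd_pos : 0 < (ν + ν') * (ω₂ / (ω₁ + ω₂)) :=
  mul_pos (add_pos h.freq_pos h.freq_pos') (div_pos h.snd_pos (add_pos h.fst_pos h.snd_pos))

/-- The ground state of the magnetic oscillator: the Gaussian annihilated by both lowering
operators. -/
noncomputable def ground : 𝓢(Plane, ℂ) :=
  gaussianState h.groundWidth_fst_pos h.groundWidth_snd_pos
    (B * (ω₂ - ω₁) / (2 * (ω₁ + ω₂)))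

lemma groundPhase_add :
    B * (ω₂ - ω₁) / (2 * (ω₁ + ω₂)) + B / 2 = B * (ω₂ / (ω₁ + ω₂)) := by
  have := (add_pos h.fst_pos h.snd_pos).ne'
  field_simp
  ring

lemma groundPhase_sub :
    B * (ω₂ - ω₁) / (2 * (ω₁ + ω₂)) - B / 2 = -(B * (ω₁ / (ω₁ + ω₂))) := by
  have := (add_pos h.fst_pos h.snd_pos).ne'
  field_simp
  ring

lemma lowerOp_ground_coeff_fst :
    B * ν * ((ν + ν') * (ω₁ / (ω₁ + ω₂)))
      + (ν ^ 2 - ω₁ ^ 2) * (B * (ω₂ - ω₁) / (2 * (ω₁ + ω₂)) - B / 2) - ω₁ ^ 2 * B = 0 := by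
  have := (add_pos h.fst_pos h.snd_pos).ne'
  rw [h.groundPhase_sub]
  field_simp
  linear_combination B * ω₁ * h.mul_eq

lemma lowerOp_ground_coeff_snd :
    B * ν * (B * (ω₂ - ω₁) / (2 * (ω₁ + ω₂)) + B / 2)
      - (ν ^ 2 - ω₁ ^ 2) * ((ν + ν') * (ω₂ / (ω₁ + ω₂)))
      + (ν * (ν ^ 2 - ω₁ ^ 2) - B ^ 2 * ν) = 0 := by
  have := (add_pos h.fst_pos h.snd_pos).ne'
  rw [h.groundPhase_add]
  refine (mul_eq_zero.1 (?_ : ν * _ = 0)).resolve_left h.freq_pos.ne'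
  field_simp
  linear_combination ω₁ * h.characteristic_eq - ω₂ * (ν ^ 2 - ω₁ ^ 2) * h.mul_eq

lemma lowerOp_ground : lowerOp B ω₁ ν h.ground = 0 := by
  have hfst := congrArg ((↑) : ℝ → ℂ) h.lowerOp_ground_coeff_fst
  have hsnd := congrArg ((↑) : ℝ → ℂ) h.lowerOp_ground_coeff_snd
  refine linOp_gaussianState_eq_zero _ _ _ _ ?_ ?_
  · push_cast at hfst ⊢
    linear_combination Complex.I * hfst
  · push_cast at hsnd ⊢
    linear_combination hsnd
      + ((ν : ℂ) ^ 2 - ω₁ ^ 2) * ((ν + ν') * (ω₂ / (ω₁ + ω₂))) * Complex.I_sq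

lemma ground_symm : h.symm.ground = h.ground := by
  ext x
  rw [ground, ground, gaussianState_apply, gaussianState_apply, add_comm ν' ν]

lemma oscOp_ground (μ : ℝ) :
    oscOp B ω₁ ω₂ μ h.ground = ((ν + ν' - μ : ℝ) : ℂ) • h.ground := by
  have hω := (add_pos h.fst_pos h.snd_pos).ne'
  have henergy := oscOp_gaussianState B (ω₁ := ω₁) (ω₂ := ω₂) h.groundWidth_fst_pos
    h.groundWidth_snd_pos (B * (ω₂ - ω₁) / (2 * (ω₁ + ω₂))) μ ?_ ?_ ?_
  · rw [ground, henergy, ← mul_add, ← add_div, div_self hω, mul_one]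
  · rw [h.groundPhase_sub, mul_pow, h.add_sq]
    field_simp
  · rw [h.groundPhase_add, mul_pow, h.add_sq]
    field_simp
  · rw [h.groundPhase_add, h.groundPhase_sub]
    ring

lemma schwartzToL2_ground_ne_zero : schwartzToL2 h.ground ≠ 0 := by
  intro hzero
  have hground : h.ground = 0 :=
    SchwartzMap.injective_toLp 2 volume (hzero.trans (map_zero schwartzToL2).symm)
  exact gaussianState_ne_zero _ _ _ 0 (DFunLike.congr_fun hground 0)

lemma isLadderPair :
    IsLadderPair schwartzToL2 (lowerOp B ω₁ ν) (raiseOp B ω₁ ν) (lowerOp B ω₁ ν')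
      (raiseOp B ω₁ ν') (ladderConst B ω₁ ν) (ladderConst B ω₁ ν') h.ground where
  fst := ⟨h.ladderConst_pos, lie_lowerOp_raiseOp B ω₁ ν, inner_lowerOp_left B ω₁ ν⟩
  snd := ⟨h.symm.ladderConst_pos, lie_lowerOp_raiseOp B ω₁ ν', inner_lowerOp_left B ω₁ ν'⟩
  commute_raise := h.commute_raiseOp_raiseOp
  commute_fst := h.commute_lowerOp_raiseOp
  commute_snd := h.symm.commute_lowerOp_raiseOp
  fst_vacuum := h.lowerOp_ground
  snd_vacuum := by rw [← h.ground_symm, h.symm.lowerOp_ground]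
  vacuum_ne_zero := h.schwartzToL2_ground_ne_zero

lemma posOp_mem_span_ladder (j : Fin 2) : posOp j ∈ Submodule.span ℂ
    {lowerOp B ω₁ ν, raiseOp B ω₁ ν, lowerOp B ω₁ ν', raiseOp B ω₁ ν'} := by
  have hsq : ((ν : ℂ) ^ 2 - ν' ^ 2) ≠ 0 := mod_cast h.sq_sub_sq_ne_zero
  have hB : (B : ℂ) ≠ 0 := mod_cast h.field_pos.ne'
  have hω₁ : (ω₁ : ℂ) ≠ 0 := mod_cast h.fst_pos.ne'
  have hν : (ν : ℂ) ≠ 0 := mod_cast h.freq_pos.ne'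
  have hν' : (ν' : ℂ) ≠ 0 := mod_cast h.freq_pos'.ne'
  have hzero : (2 * Complex.I * ω₁ ^ 2 * B * ((ν : ℂ) ^ 2 - ν' ^ 2)) • posOp 0 =
      ((ν' : ℂ) ^ 2 - ω₁ ^ 2) • (lowerOp B ω₁ ν - raiseOp B ω₁ ν) -
        ((ν : ℂ) ^ 2 - ω₁ ^ 2) • (lowerOp B ω₁ ν' - raiseOp B ω₁ ν') := by
    simp only [lowerOp, raiseOp, linOp]
    module
  have hone : (2 * (ν : ℂ) * ν' * (ν ^ 2 - ν' ^ 2)) • posOp 1 =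
      (ν' : ℂ) • (lowerOp B ω₁ ν + raiseOp B ω₁ ν) -
        (ν : ℂ) • (lowerOp B ω₁ ν' + raiseOp B ω₁ ν') := by
    simp only [lowerOp, raiseOp, linOp]
    module
  set W := Submodule.span ℂ {lowerOp B ω₁ ν, raiseOp B ω₁ ν, lowerOp B ω₁ ν', raiseOp B ω₁ ν'}
  have hmem : ∀ q ∈ ({lowerOp B ω₁ ν, raiseOp B ω₁ ν, lowerOp B ω₁ ν', raiseOp B ω₁ ν'} :
      Set (Module.End ℂ 𝓢(Plane, ℂ))), q ∈ W := fun q hq => Submodule.subset_span hq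
  simp only [Set.mem_insert_iff, Set.mem_singleton_iff, forall_eq_or_imp, forall_eq] at hmem
  obtain ⟨ha, ha', hb, hb'⟩ := hmem
  match j with
  | 0 =>
    have hne : 2 * Complex.I * (ω₁ : ℂ) ^ 2 * B * (ν ^ 2 - ν' ^ 2) ≠ 0 := by simp [hsq, hB, hω₁]
    rw [← W.smul_mem_iff hne, hzero]
    exact W.sub_mem (W.smul_mem _ (W.sub_mem ha ha')) (W.smul_mem _ (W.sub_mem hb hb'))
  | 1 =>
    have hne : 2 * (ν : ℂ) * ν' * (ν ^ 2 - ν' ^ 2) ≠ 0 := by simp [hsq, hν, hν']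
    rw [← W.smul_mem_iff hne, hone]
    exact W.sub_mem (W.smul_mem _ (W.add_mem ha ha')) (W.smul_mem _ (W.add_mem hb hb'))

lemma eq_zero_of_inner_ladderState_eq_zero {f : L2Plane} (hf : ∀ p, ⟪schwartzToL2
    (ladderState (raiseOp B ω₁ ν) (raiseOp B ω₁ ν') h.ground p), f⟫_ℂ = 0) : f = 0 := by
  have hmem : h.ground ∈ ladderSpan (raiseOp B ω₁ ν) (raiseOp B ω₁ ν') h.ground :=
    Submodule.subset_span ⟨(0, 0), by simp [ladderState]⟩
  refine eq_zero_of_inner_eq_zero_of_gaussian_mem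
    (fun j => h.isLadderPair.ladderSpan_le_comap (h.posOp_mem_span_ladder j))
    hmem (gaussianState_ne_zero _ _ _)
    (half_pos (lt_min h.groundWidth_fst_pos h.groundWidth_snd_pos))
    (norm_gaussianState_le _ _ _) fun u hu => ?_
  induction hu using Submodule.span_induction with
  | mem u hu =>
    obtain ⟨p, rfl⟩ := hu
    exact hf p
  | zero => simp
  | add u v _ _ hu hv => rw [map_add, inner_add_left, hu, hv, add_zero]
  | smul c u _ hu => rw [map_smul, inner_smul_left, hu, mul_zero]

lemma oscOp_ladderState (μ : ℝ) (p : ℕ × ℕ) :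
    oscOp B ω₁ ω₂ μ (ladderState (raiseOp B ω₁ ν) (raiseOp B ω₁ ν') h.ground p) =
      (((2 * p.1 + 1) * ν + (2 * p.2 + 1) * ν' - μ : ℝ) : ℂ) •
        ladderState (raiseOp B ω₁ ν) (raiseOp B ω₁ ν') h.ground p := by
  rw [apply_ladderState (h.lie_oscOp_raiseOp μ) (h.symm.lie_oscOp_raiseOp μ) (h.oscOp_ground μ)]
  congr 1
  push_cast
  ring

end IsFreqPair

lemma mem_magSchrodingerGraph_iff {B ω₁ ω₂ μ : ℝ} {p : L2Plane × L2Plane} :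
    p ∈ magSchrodingerGraph B (oscPotential ω₁ ω₂ μ) ↔
      ∃ φ, schwartzToL2 φ = p.1 ∧ schwartzToL2 (oscOp B ω₁ ω₂ μ φ) = p.2 := by
  refine exists_congr fun φ => ?_
  rw [← coe_oscOp, Lp.ext_iff, Lp.ext_iff, (coeFn_schwartzToL2 φ).congr_left,
    (coeFn_schwartzToL2 (oscOp B ω₁ ω₂ μ φ)).congr_left]
  exact and_congr Filter.eventuallyEq_comm Filter.eventuallyEq_comm

theorem IsFreqPair.exists_isDiagonal_magSchrodinger {B ω₁ ω₂ ν ν' : ℝ}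
    (h : IsFreqPair B ω₁ ω₂ ν ν') (μ : ℝ) :
    ∃ e : HilbertBasis (ℕ × ℕ) ℂ L2Plane,
      IsDiagonal e (fun p => (2 * p.1 + 1) * ν + (2 * p.2 + 1) * ν' - μ)
        (magSchrodinger B (oscPotential ω₁ ω₂ μ)) := by
  refine exists_isDiagonal_closure ?_ h.isLadderPair.map_ladderState_ne_zero
    h.isLadderPair.pairwise_inner_eq_zero (fun f => h.eq_zero_of_inner_ladderState_eq_zero)
    fun p => mem_magSchrodingerGraph_iff.2 ⟨_, rfl, ?_⟩
  · simp only [mem_magSchrodingerGraph_iff]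
    rintro p ⟨f, hf, hf'⟩ q ⟨g, hg, hg'⟩
    rw [← hf, ← hf', ← hg, ← hg', inner_oscOp_left]
  · rw [h.oscOp_ladderState, map_smul]

end Spectrum

/-! ### The semiclassical integral -/

section Semiclassical

lemma lintegral_comp_diagonal {a b : ℝ} (ha : 0 < a) (hb : 0 < b) {F : Plane → ℝ≥0∞}
    (hF : Measurable F) :
    ∫⁻ x : Plane, F !₂[a * x 0, b * x 1] = ENNReal.ofReal (a * b)⁻¹ * ∫⁻ x, F x := by
  set L : Plane →ₗ[ℝ] Plane := Matrix.toLpLin 2 2 (Matrix.diagonal ![a, b]) with hL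
  have hdet : LinearMap.det L = a * b := by
    rw [hL, Matrix.toLpLin_eq_toLin, LinearMap.det_toLin, Matrix.det_diagonal]
    simp
  have happly (x : Plane) : L x = !₂[a * x 0, b * x 1] := by
    ext i
    rw [hL, Matrix.toLpLin_apply]
    fin_cases i <;> simp [Matrix.mulVec_diagonal]
  calc ∫⁻ x : Plane, F !₂[a * x 0, b * x 1]
    _ = ∫⁻ y, F y ∂(volume.map L) := by
      simp_rw [← happly]
      exact (lintegral_map hF L.continuous_of_finiteDimensional.measurable).symm
    _ = ENNReal.ofReal (a * b)⁻¹ * ∫⁻ x, F x := by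
      rw [Measure.map_linearMap_addHaar_eq_smul_addHaar volume (by rw [hdet]; positivity),
        lintegral_smul_measure, hdet, abs_of_pos (by positivity), smul_eq_mul]

lemma negPart_sq_sub_eq_zero {E r : ℝ} (hr : √E ≤ r) : (r ^ 2 - E)⁻ = 0 :=
  negPart_eq_zero.2 (sub_nonneg.2 (Real.sqrt_le_iff.1 hr).2)

lemma integral_Ioi_mul_negPart {E : ℝ} (hE : 0 ≤ E) :
    ∫ r in Set.Ioi (0 : ℝ), r * (r ^ 2 - E)⁻ = E ^ 2 / 4 := by
  have hroot : √E ^ 2 = E := Real.sq_sqrt hE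
  have hsupport : Set.EqOn (fun r => r * (r ^ 2 - E)⁻) 0 (Set.Ioi 0 \ Set.Ioc 0 √E) :=
    fun r hr => by
      have hle : √E ≤ r := le_of_not_ge fun hlt => hr.2 ⟨hr.1, hlt⟩
      simp [negPart_sq_sub_eq_zero hle]
  have hinside : Set.EqOn (fun r => r * (r ^ 2 - E)⁻) (fun r => E * r - r ^ 3) (Set.Ioc 0 √E) :=
    fun r hr => by
      have hle : r ^ 2 - E ≤ 0 := by nlinarith [hr.1, hr.2]
      simp only [negPart_of_nonpos hle]
      ring
  calc ∫ r in Set.Ioi (0 : ℝ), r * (r ^ 2 - E)⁻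
    _ = ∫ r in Set.Ioc 0 √E, r * (r ^ 2 - E)⁻ :=
      setIntegral_eq_of_subset_of_forall_sdiff_eq_zero measurableSet_Ioi
        Set.Ioc_subset_Ioi_self hsupport
    _ = ∫ r in Set.Ioc 0 √E, (E * r - r ^ 3) := setIntegral_congr_fun measurableSet_Ioc hinside
    _ = E * (√E ^ 2 / 2) - √E ^ 4 / 4 := by
      rw [← intervalIntegral.integral_of_le (Real.sqrt_nonneg E), intervalIntegral.integral_sub
        (Continuous.intervalIntegrable (by fun_prop) _ _)
        (Continuous.intervalIntegrable (by fun_prop) _ _), intervalIntegral.integral_const_mul,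
        integral_id, integral_pow]
      norm_num
    _ = E ^ 2 / 4 := by
      linear_combination (E / 4 - √E ^ 2 / 4) * hroot

lemma continuous_negPart_norm_sq_sub (E : ℝ) : Continuous fun x : Plane => (‖x‖ ^ 2 - E)⁻ := by
  simp only [negPart_def]
  fun_prop

lemma integrable_negPart_norm_sq_sub (E : ℝ) :
    Integrable fun x : Plane => (‖x‖ ^ 2 - E)⁻ :=
  (continuous_negPart_norm_sq_sub E).integrable_of_hasCompactSupport <|
    HasCompactSupport.intro (isCompact_closedBall 0 √E) fun x hx =>
      negPart_sq_sub_eq_zero (by simpa using (not_le.1 (mt mem_closedBall_zero_iff.2 hx)).le)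

lemma lintegral_negPart_norm_sq_sub (E : ℝ) :
    ∫⁻ x : Plane, ENNReal.ofReal (‖x‖ ^ 2 - E)⁻ = ENNReal.ofReal (Real.pi / 2 * E⁺ ^ 2) := by
  rcases le_total E 0 with hE | hE
  · have hzero (x : Plane) : (‖x‖ ^ 2 - E)⁻ = 0 :=
      negPart_eq_zero.2 (sub_nonneg.2 (hE.trans (sq_nonneg _)))
    simp [hzero, posPart_eq_zero.2 hE]
  have hball : (volume : Measure Plane).real (Metric.ball 0 1) = Real.pi := by
    rw [Measure.real, EuclideanSpace.volume_ball_fin_two]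
    simp [Real.pi_pos.le]
  rw [← ofReal_integral_eq_lintegral_ofReal (integrable_negPart_norm_sq_sub E)
    (.of_forall fun x => negPart_nonneg _), integral_fun_norm_addHaar volume
    (fun r => (r ^ 2 - E)⁻), hball, posPart_of_nonneg hE]
  simp only [finrank_euclideanSpace, Fintype.card_fin, Nat.add_one_sub_one, pow_one, smul_eq_mul,
    nsmul_eq_mul]
  rw [integral_Ioi_mul_negPart hE]
  congr 1
  push_cast
  ring

lemma lintegral_negPart_add_oscPotential {ω₁ ω₂ : ℝ} (h₁ : 0 < ω₁) (h₂ : 0 < ω₂) (μ b : ℝ) :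
    ∫⁻ x : Plane, ENNReal.ofReal (b + oscPotential ω₁ ω₂ μ x)⁻ =
      ENNReal.ofReal (Real.pi / (2 * (ω₁ * ω₂)) * (μ - b)⁺ ^ 2) := by
  have hnorm (x : Plane) : b + oscPotential ω₁ ω₂ μ x =
      ‖(!₂[ω₁ * x 0, ω₂ * x 1] : Plane)‖ ^ 2 - (μ - b) := by
    rw [norm_sq_plane, oscPotential]
    simp only [Matrix.cons_val_zero, Matrix.cons_val_one]
    ring
  simp_rw [hnorm]
  rw [lintegral_comp_diagonal h₁ h₂ (F := fun y => ENNReal.ofReal (‖y‖ ^ 2 - (μ - b))⁻)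
    (continuous_negPart_norm_sq_sub (μ - b)).measurable.ennreal_ofReal,
    lintegral_negPart_norm_sq_sub, ← ENNReal.ofReal_mul (by positivity)]
  congr 1
  field_simp

lemma magSemiclassical_oscPotential {B ω₁ ω₂ : ℝ} (hB : 0 < B) (h₁ : 0 < ω₁) (h₂ : 0 < ω₂)
    (μ : ℝ) : magSemiclassical B (oscPotential ω₁ ω₂ μ) =
      ∑' m : ℕ, ENNReal.ofReal (B / (4 * (ω₁ * ω₂)) * (μ - (2 * m + 1) * B)⁺ ^ 2) := by
  rw [magSemiclassical, ← ENNReal.tsum_mul_left]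
  refine tsum_congr fun m => ?_
  rw [lintegral_negPart_add_oscPotential h₁ h₂, ← ENNReal.ofReal_mul (by positivity)]
  congr 1
  have := Real.pi_pos.ne'
  field_simp
  ring

end Semiclassical

/-! ### Riemann sums of the positive part -/

section RiemannSums

lemma four_mul_posPart_le {h : ℝ} (hh : 0 ≤ h) (t : ℝ) :
    4 * h * t⁺ ≤ (t + h)⁺ ^ 2 - (t - h)⁺ ^ 2 := by
  simp only [posPart_def]
  rcases le_total t 0 with ht | ht
  · rw [max_eq_right ht, max_eq_right (by linarith : t - h ≤ 0)]
    nlinarith [sq_nonneg (max (t + h) 0)]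
  rw [max_eq_left ht, max_eq_left (by linarith : 0 ≤ t + h)]
  rcases le_total t h with hth | hth
  · rw [max_eq_right (by linarith : t - h ≤ 0)]
    nlinarith [sq_nonneg (t - h)]
  · rw [max_eq_left (by linarith : 0 ≤ t - h)]
    nlinarith

lemma posPart_sq_sub_posPart_sq_le (h t : ℝ) : t⁺ ^ 2 - (t - 2 * h)⁺ ^ 2 ≤ 4 * h * t⁺ := by
  simp only [posPart_def]
  rcases le_total t 0 with ht | ht
  · rw [max_eq_right ht]
    nlinarith [sq_nonneg (max (t - 2 * h) 0)]
  rw [max_eq_left ht]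
  rcases le_total t (2 * h) with hth | hth
  · rw [max_eq_right (by linarith : t - 2 * h ≤ 0)]
    nlinarith
  · rw [max_eq_left (by linarith : 0 ≤ t - 2 * h)]
    nlinarith [sq_nonneg h]

/-- The left-hand side is a midpoint sum, with step `2h`, of the convex function `(x - E)⁻`, whose
integral over `[0, ∞)` is `(E⁺)² / 2`. -/
lemma tsum_negPart_le {h : ℝ} (hh : 0 < h) (E : ℝ) :
    ∑' k : ℕ, ENNReal.ofReal ((2 * k + 1) * h - E)⁻ ≤ ENNReal.ofReal (E⁺ ^ 2 / (4 * h)) := by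
  rw [ENNReal.tsum_eq_iSup_nat]
  refine iSup_le fun n => ?_
  rw [← ENNReal.ofReal_sum_of_nonneg fun _ _ => negPart_nonneg _]
  refine ENNReal.ofReal_le_ofReal ?_
  set F : ℕ → ℝ := fun k => (E - 2 * k * h)⁺ ^ 2 / (4 * h) with hF
  have hstep (k : ℕ) : ((2 * k + 1) * h - E)⁻ ≤ F k - F (k + 1) := by
    have hmid := four_mul_posPart_le hh.le (E - (2 * k + 1) * h)
    rw [← sub_div, le_div_iff₀ (by positivity), ← posPart_neg, neg_sub, mul_comm]
    exact hmid.trans_eq (by push_cast; ring_nf)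
  calc ∑ k ∈ Finset.range n, ((2 * k + 1) * h - E)⁻
    _ ≤ ∑ k ∈ Finset.range n, (F k - F (k + 1)) := Finset.sum_le_sum fun k _ => hstep k
    _ = F 0 - F n := Finset.sum_range_sub' F n
    _ ≤ F 0 := sub_le_self _ (by positivity)
    _ = E⁺ ^ 2 / (4 * h) := by simp [hF]

/-- The right-hand side is a left-endpoint sum, with step `2h`, of the nonincreasing function
`(x - E)⁻` over `[h, ∞)`. -/
lemma le_tsum_negPart {h : ℝ} (hh : 0 < h) (E : ℝ) :
    ENNReal.ofReal ((E - h)⁺ ^ 2 / (4 * h)) ≤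
      ∑' k : ℕ, ENNReal.ofReal ((2 * k + 1) * h - E)⁻ := by
  obtain ⟨n, hn⟩ := exists_nat_gt (E / h)
  rw [div_lt_iff₀ hh] at hn
  refine le_trans ?_ (ENNReal.sum_le_tsum (Finset.range n))
  rw [← ENNReal.ofReal_sum_of_nonneg fun _ _ => negPart_nonneg _]
  refine ENNReal.ofReal_le_ofReal ?_
  set F : ℕ → ℝ := fun k => (E - (2 * k + 1) * h)⁺ ^ 2 / (4 * h) with hF
  have hstep (k : ℕ) : F k - F (k + 1) ≤ ((2 * k + 1) * h - E)⁻ := by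
    have hleft := posPart_sq_sub_posPart_sq_le h (E - (2 * k + 1) * h)
    rw [← sub_div, div_le_iff₀ (by positivity), ← posPart_neg, neg_sub, mul_comm _ (4 * h)]
    exact hleft.trans_eq' (by push_cast; ring_nf)
  have hlast : F n = 0 := by
    have hle : E - (2 * n + 1) * h ≤ 0 := by nlinarith
    simp [hF, posPart_eq_zero.2 hle]
  calc (E - h)⁺ ^ 2 / (4 * h)
    _ = F 0 - F n := by rw [hlast]; simp [hF]
    _ = ∑ k ∈ Finset.range n, (F k - F (k + 1)) := (Finset.sum_range_sub' F n).symm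
    _ ≤ ∑ k ∈ Finset.range n, ((2 * k + 1) * h - E)⁻ := Finset.sum_le_sum fun k _ => hstep k

lemma hasDerivAt_posPart_sq (x : ℝ) : HasDerivAt (fun y : ℝ => y⁺ ^ 2) (2 * x⁺) x := by
  have hlittle : (fun y : ℝ => (y - x) ^ 2) =o[nhds x] fun y => y - x := by
    simpa using Asymptotics.isLittleO_pow_sub_sub x one_lt_two
  rw [hasDerivAt_iff_isLittleO]
  refine Asymptotics.IsBigO.trans_isLittleO
    (Asymptotics.IsBigO.of_bound 1 (.of_forall fun y => ?_)) hlittle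
  rw [Real.norm_eq_abs, Real.norm_of_nonneg (sq_nonneg (y - x)), one_mul, abs_le, smul_eq_mul]
  simp only [posPart_def]
  rcases le_total x 0 with hx | hx <;> rcases le_total y 0 with hy | hy <;>
    simp only [max_eq_left, max_eq_right, hx, hy] <;> constructor <;> nlinarith

lemma sum_range_sub_mul_sub_three_mul (μ t : ℝ) (n : ℕ) :
    ∑ j ∈ Finset.range n, (μ - (2 * j + 1) * t) * (μ - 3 * ((2 * j + 1) * t)) =
      n * ((μ - 2 * n * t) ^ 2 - t ^ 2) := by
  induction n with
  | zero => simp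
  | succ n ih =>
    rw [Finset.sum_range_succ, ih]
    push_cast
    ring

lemma sum_posPart_mul_nonpos {μ t : ℝ} (ht : 0 ≤ t) {n : ℕ} (hn : μ ≤ (2 * n + 1) * t) :
    ∑ j ∈ Finset.range n, (μ - (2 * j + 1) * t)⁺ * (μ - 3 * ((2 * j + 1) * t)) ≤ 0 := by
  induction n with
  | zero => simp
  | succ n ih =>
    rcases le_or_gt μ ((2 * n + 1) * t) with hle | hlt
    · rw [Finset.sum_range_succ, posPart_eq_zero.2 (sub_nonpos.2 hle), zero_mul, add_zero]
      exact ih hle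
    have hpos : ∀ j ∈ Finset.range (n + 1), (μ - (2 * j + 1) * t)⁺ = μ - (2 * j + 1) * t := by
      intro j hj
      have hjn : (j : ℝ) ≤ n := mod_cast Finset.mem_range_succ_iff.1 hj
      refine posPart_of_nonneg (sub_nonneg.2 (le_trans ?_ hlt.le))
      gcongr
    rw [Finset.sum_congr rfl fun j hj => by rw [hpos j hj], sum_range_sub_mul_sub_three_mul]
    push_cast at hn ⊢
    refine mul_nonpos_of_nonneg_of_nonpos (by positivity) ?_
    nlinarith

lemma hasDerivAt_mul_sum_posPart_sq (μ t : ℝ) (n : ℕ) :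
    HasDerivAt (fun t : ℝ => t * ∑ j ∈ Finset.range n, (μ - (2 * j + 1) * t)⁺ ^ 2)
      (∑ j ∈ Finset.range n, (μ - (2 * j + 1) * t)⁺ * (μ - 3 * ((2 * j + 1) * t))) t := by
  have hterm : ∀ j ∈ Finset.range n, HasDerivAt (fun t : ℝ => (μ - (2 * (j : ℝ) + 1) * t)⁺ ^ 2)
      (2 * (μ - (2 * (j : ℝ) + 1) * t)⁺ * -(2 * (j : ℝ) + 1)) t := fun j _ =>
    (hasDerivAt_posPart_sq _).comp t ((hasDerivAt_const_mul _).const_sub μ)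
  refine ((hasDerivAt_id' t).mul (HasDerivAt.fun_sum hterm)).congr_deriv ?_
  rw [one_mul, Finset.mul_sum, ← Finset.sum_add_distrib]
  refine Finset.sum_congr rfl fun j _ => ?_
  have hsq (x : ℝ) : x⁺ ^ 2 = x⁺ * x := by
    rcases le_total x 0 with hx | hx
    · simp [posPart_eq_zero.2 hx]
    · rw [posPart_of_nonneg hx, sq]
  rw [hsq]
  ring

lemma antitoneOn_mul_sum_posPart_sq {B μ : ℝ} (hB : 0 ≤ B) {n : ℕ} (hn : μ ≤ (2 * n + 1) * B) :
    AntitoneOn (fun t : ℝ => t * ∑ j ∈ Finset.range n, (μ - (2 * j + 1) * t)⁺ ^ 2)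
      (Set.Ici B) := by
  refine antitoneOn_of_deriv_nonpos (convex_Ici B)
    (fun t _ => (hasDerivAt_mul_sum_posPart_sq μ t n).continuousAt.continuousWithinAt)
    (fun t _ => (hasDerivAt_mul_sum_posPart_sq μ t n).differentiableAt.differentiableWithinAt)
    fun t ht => ?_
  have hBt : B ≤ t := interior_subset ht
  rw [(hasDerivAt_mul_sum_posPart_sq μ t n).deriv]
  refine sum_posPart_mul_nonpos (hB.trans hBt) (hn.trans ?_)
  gcongr

end RiemannSums

/-! ### The trace of the negative part -/

section Trace

variable {B ω₁ ω₂ ν ν' : ℝ}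

namespace IsFreqPair

lemma exists_finset_eigenvalue_nonneg (h : IsFreqPair B ω₁ ω₂ ν ν') (μ : ℝ) :
    ∃ s : Finset (ℕ × ℕ), ∀ p ∉ s, 0 ≤ (2 * (p.1 : ℝ) + 1) * ν + (2 * p.2 + 1) * ν' - μ := by
  have hν := h.freq_pos
  have hν' := h.freq_pos'
  obtain ⟨n, hn⟩ := exists_nat_gt (μ / ν)
  obtain ⟨n', hn'⟩ := exists_nat_gt (μ / ν')
  rw [div_lt_iff₀ hν] at hn
  rw [div_lt_iff₀ hν'] at hn'
  refine ⟨Finset.range n ×ˢ Finset.range n', fun p hp => ?_⟩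
  have hfst : 0 ≤ p.1 * ν := by positivity
  have hsnd : 0 ≤ p.2 * ν' := by positivity
  rw [Finset.mem_product, Finset.mem_range, Finset.mem_range, not_and_or, not_lt, not_lt] at hp
  rcases hp with hp | hp
  · have : (n : ℝ) * ν ≤ p.1 * ν := by gcongr
    linarith
  · have : (n' : ℝ) * ν' ≤ p.2 * ν' := by gcongr
    linarith

lemma negTrace_eq (h : IsFreqPair B ω₁ ω₂ ν ν') (μ : ℝ) :
    negTrace (magSchrodinger B (oscPotential ω₁ ω₂ μ)) =
      ∑' j : ℕ, ∑' k : ℕ, ENNReal.ofReal ((2 * k + 1) * ν' - (μ - (2 * j + 1) * ν))⁻ := by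
  obtain ⟨e, hdiag⟩ := h.exists_isDiagonal_magSchrodinger μ
  obtain ⟨s, hs⟩ := h.exists_finset_eigenvalue_nonneg μ
  obtain ⟨N, hN, -⟩ := hdiag.existsUnique_isNegPart hs
  rw [hdiag.negTrace_eq_tsum hN, ENNReal.tsum_prod']
  refine tsum_congr fun j => tsum_congr fun k => ?_
  congr 2
  ring

lemma div_four_mul_freq (h : IsFreqPair B ω₁ ω₂ ν ν') (x : ℝ) :
    x / (4 * ν') = ν * x / (4 * (ω₁ * ω₂)) := by
  have := h.freq_pos.ne'
  have := h.freq_pos'.ne'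
  rw [← h.mul_eq]
  field_simp

lemma negTrace_le_tsum (h : IsFreqPair B ω₁ ω₂ ν ν') (μ : ℝ) :
    negTrace (magSchrodinger B (oscPotential ω₁ ω₂ μ)) ≤
      ∑' j : ℕ, ENNReal.ofReal (ν / (4 * (ω₁ * ω₂)) * (μ - (2 * j + 1) * ν)⁺ ^ 2) := by
  rw [h.negTrace_eq]
  refine ENNReal.tsum_le_tsum fun j => (tsum_negPart_le h.freq_pos' _).trans_eq ?_
  rw [h.div_four_mul_freq, mul_div_right_comm]

end IsFreqPair

lemma tsum_ofReal_posPart_sq_eq_sum {B μ t c : ℝ} (hB : 0 ≤ B) (hBt : B ≤ t) (hc : 0 ≤ c) {n : ℕ}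
    (hn : μ ≤ (2 * n + 1) * B) :
    ∑' j : ℕ, ENNReal.ofReal (t / c * (μ - (2 * j + 1) * t)⁺ ^ 2) =
      ENNReal.ofReal ((t * ∑ j ∈ Finset.range n, (μ - (2 * j + 1) * t)⁺ ^ 2) / c) := by
  have ht : 0 ≤ t := hB.trans hBt
  rw [tsum_eq_sum (s := Finset.range n), ← ENNReal.ofReal_sum_of_nonneg fun j _ => by positivity,
    ← Finset.mul_sum, div_mul_eq_mul_div]
  intro j hj
  have hnj : (n : ℝ) ≤ j := mod_cast not_lt.1 (mt Finset.mem_range.2 hj)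
  have hμ : μ ≤ (2 * j + 1) * t := hn.trans (by gcongr)
  simp [posPart_eq_zero.2 (sub_nonpos.2 hμ)]

lemma tsum_ofReal_posPart_sq_le {B ν c : ℝ} (hB : 0 < B) (hBν : B ≤ ν) (hc : 0 ≤ c) (μ : ℝ) :
    ∑' j : ℕ, ENNReal.ofReal (ν / c * (μ - (2 * j + 1) * ν)⁺ ^ 2) ≤
      ∑' j : ℕ, ENNReal.ofReal (B / c * (μ - (2 * j + 1) * B)⁺ ^ 2) := by
  obtain ⟨n, hn⟩ := exists_nat_gt (μ / B)
  have hμ : μ ≤ (2 * n + 1) * B := by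
    rw [div_lt_iff₀ hB] at hn
    nlinarith [Nat.cast_nonneg (α := ℝ) n]
  rw [tsum_ofReal_posPart_sq_eq_sum hB.le hBν hc hμ,
    tsum_ofReal_posPart_sq_eq_sum hB.le le_rfl hc hμ]
  exact ENNReal.ofReal_le_ofReal <| div_le_div_of_nonneg_right
    (antitoneOn_mul_sum_posPart_sq hB.le hμ Set.self_mem_Ici hBν hBν) hc

namespace IsFreqPair

theorem negTrace_le (h : IsFreqPair B ω₁ ω₂ ν ν') (hBν : B ≤ ν) (μ : ℝ) :
    negTrace (magSchrodinger B (oscPotential ω₁ ω₂ μ)) ≤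
      magSemiclassical B (oscPotential ω₁ ω₂ μ) := by
  have hω : 0 ≤ 4 * (ω₁ * ω₂) := mul_nonneg zero_le_four (mul_pos h.fst_pos h.snd_pos).le
  rw [magSemiclassical_oscPotential h.field_pos h.fst_pos h.snd_pos]
  exact (h.negTrace_le_tsum μ).trans (tsum_ofReal_posPart_sq_le h.field_pos hBν hω μ)

/-- Only the terms `j = 0` of the double sum for the trace are kept. -/
lemma le_negTrace (h : IsFreqPair B ω₁ ω₂ ν ν') (μ : ℝ) :
    ENNReal.ofReal (ν * (μ - (ν + ν'))⁺ ^ 2 / (4 * (ω₁ * ω₂))) ≤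
      negTrace (magSchrodinger B (oscPotential ω₁ ω₂ μ)) := by
  rw [h.negTrace_eq, ← h.div_four_mul_freq, ← sub_sub]
  refine le_trans ?_ (ENNReal.le_tsum 0)
  simpa using le_tsum_negPart h.freq_pos' (μ - ν)

end IsFreqPair

lemma exists_isFreqPair (hB : 0 < B) (h₁ : 0 < ω₁) (h₂ : 0 < ω₂) :
    ∃ ν ν', B ≤ ν ∧ IsFreqPair B ω₁ ω₂ ν ν' := by
  set S := √((ω₁ + ω₂) ^ 2 + B ^ 2)
  set D := √((ω₁ - ω₂) ^ 2 + B ^ 2)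
  have hS : S ^ 2 = (ω₁ + ω₂) ^ 2 + B ^ 2 := Real.sq_sqrt (by positivity)
  have hD : D ^ 2 = (ω₁ - ω₂) ^ 2 + B ^ 2 := Real.sq_sqrt (by positivity)
  have hBD : B ≤ D := Real.le_sqrt_of_sq_le (le_add_of_nonneg_left (sq_nonneg _))
  have hDS : D < S := Real.sqrt_lt_sqrt (by positivity) (by nlinarith [mul_pos h₁ h₂])
  refine ⟨(S + D) / 2, (S - D) / 2, by linarith, hB, h₁, h₂, by linarith, by linarith,
    fun heq => by linarith, ?_, ?_⟩
  · linear_combination (hS - hD) / 4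
  · linear_combination (hS + hD) / 2

lemma magSemiclassical_isotropic (hB : 0 < B) {w : ℝ} (hw : 0 < w) :
    magSemiclassical B (oscPotential w w (2 * B)) =
      ENNReal.ofReal (B * B ^ 2 / (4 * (w * w))) := by
  rw [magSemiclassical_oscPotential hB hw hw, tsum_eq_single 0 fun m hm => ?_]
  · have hgap : 2 * B - (2 * (0 : ℕ) + 1) * B = B := by push_cast; ring
    rw [hgap, posPart_of_nonneg hB.le, div_mul_eq_mul_div]
  · have hm' : (1 : ℝ) ≤ m := mod_cast Nat.one_le_iff_ne_zero.2 hm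
    have hneg : 2 * B - (2 * m + 1) * B ≤ 0 := by nlinarith
    simp [posPart_eq_zero.2 hneg]

lemma le_of_negTrace_isotropic_le (hB : 0 < B) {w : ℝ} (hw : 0 < w) {ρ : ℝ≥0∞}
    (hρ : negTrace (magSchrodinger B (oscPotential w w (2 * B))) ≤
      ρ * magSemiclassical B (oscPotential w w (2 * B))) :
    ENNReal.ofReal ((2 * B - √((w + w) ^ 2 + B ^ 2))⁺ ^ 2 / B ^ 2) ≤ ρ := by
  obtain ⟨ν, ν', hBν, h⟩ := exists_isFreqPair hB hw hw
  have hsum : √((w + w) ^ 2 + B ^ 2) = ν + ν' := by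
    rw [← h.add_sq, Real.sqrt_sq (add_pos h.freq_pos h.freq_pos').le]
  have hle := (h.le_negTrace (2 * B)).trans hρ
  rw [magSemiclassical_isotropic hB hw] at hle
  have hdiv := ENNReal.div_le_of_le_mul hle
  rw [← ENNReal.ofReal_div_of_pos (by positivity)] at hdiv
  refine le_trans (ENNReal.ofReal_le_ofReal ?_) hdiv
  calc (2 * B - √((w + w) ^ 2 + B ^ 2))⁺ ^ 2 / B ^ 2
    _ = B * (2 * B - (ν + ν'))⁺ ^ 2 / (4 * (w * w)) / (B * B ^ 2 / (4 * (w * w))) := by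
      rw [hsum]
      field_simp
    _ ≤ ν * (2 * B - (ν + ν'))⁺ ^ 2 / (4 * (w * w)) / (B * B ^ 2 / (4 * (w * w))) := by gcongr

/-- The semiclassical limit: an isotropic oscillator of frequency `w → 0` at fixed `μ = 2 B`, where
only the lowest Landau level contributes. -/
theorem one_le_of_forall_negTrace_le (hB : 0 < B) {ρ : ℝ≥0∞}
    (hρ : ∀ w : ℝ, 0 < w → negTrace (magSchrodinger B (oscPotential w w (2 * B))) ≤
      ρ * magSemiclassical B (oscPotential w w (2 * B))) : 1 ≤ ρ := by
  set ratio : ℝ → ℝ≥0∞ := fun w =>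
    ENNReal.ofReal ((2 * B - √((w + w) ^ 2 + B ^ 2))⁺ ^ 2 / B ^ 2) with hratio
  have hcont : Continuous ratio := by
    simp only [hratio, posPart_def]
    exact ENNReal.continuous_ofReal.comp (by fun_prop)
  have hzero : ratio 0 = 1 := by
    have hgap : 2 * B - √((0 + 0) ^ 2 + B ^ 2) = B := by
      rw [add_zero, zero_pow two_ne_zero, zero_add, Real.sqrt_sq hB.le]
      ring
    simp only [hratio]
    rw [hgap, posPart_of_nonneg hB.le, div_self (by positivity), ENNReal.ofReal_one]
  have hlim : Filter.Tendsto ratio (nhdsWithin 0 (Set.Ioi 0)) (nhds 1) :=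
    hzero ▸ (hcont.tendsto 0).mono_left nhdsWithin_le_nhds
  exact le_of_tendsto hlim (eventually_nhdsWithin_of_forall fun w hw =>
    le_of_negTrace_isotropic_le hB hw (hρ w hw))

end Trace

theorem theorem1p2 (B : ℝ) (hB : 0 < B) :
    (∀ ω₁ ω₂ μ : ℝ, 0 < ω₁ → 0 < ω₂ → 0 < μ →
      IsSelfAdjoint (magSchrodinger B (oscPotential ω₁ ω₂ μ)) ∧
      (∃! N : L2Plane →L[ℂ] L2Plane,
        IsNegPart (magSchrodinger B (oscPotential ω₁ ω₂ μ)) N) ∧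
      negTrace (magSchrodinger B (oscPotential ω₁ ω₂ μ)) ≤
        magSemiclassical B (oscPotential ω₁ ω₂ μ)) ∧
    (∀ ρ : ℝ≥0∞,
      (∀ ω₁ ω₂ μ : ℝ, 0 < ω₁ → 0 < ω₂ → 0 < μ →
        negTrace (magSchrodinger B (oscPotential ω₁ ω₂ μ)) ≤
          ρ * magSemiclassical B (oscPotential ω₁ ω₂ μ)) →
      1 ≤ ρ) := by
  refine ⟨fun ω₁ ω₂ μ h₁ h₂ _ => ?_, fun ρ hρ => ?_⟩
  · obtain ⟨ν, ν', hBν, hfreq⟩ := exists_isFreqPair hB h₁ h₂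
    obtain ⟨e, hdiag⟩ := hfreq.exists_isDiagonal_magSchrodinger μ
    obtain ⟨s, hs⟩ := hfreq.exists_finset_eigenvalue_nonneg μ
    exact ⟨hdiag.isSelfAdjoint, hdiag.existsUnique_isNegPart hs, hfreq.negTrace_le hBν μ⟩
  · exact one_le_of_forall_negTrace_le hB fun w hw => hρ w w (2 * B) hw hw (by positivity)
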